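/- Let $p$ be a prime, $q=p^e$, $m\ge 1$, $n\ge 0$, $k\ge 1$. Let $\nu_p$ be the $p$-adic valuation on $\mathbb{C}_p$ (the completion of an algebraic closure of $\mathbb{Q}_p$), normalised by $\nu_p(p)=1$, with $\nu_p(0)=\infty$. Let $\xi\in\mathbb{C}_p$ be a primitive $(q^m-1)$-st root of unity, and identify the residue field $\mathbb{Z}_p[\xi]/(p)$ with $\mathbb{F}_{q^m}$ by any ring isomorphism. Let $T:\mathbb{F}_{q^m}\to\mathbb{Z}_p[\xi]$ be the Teichmüller lift: $T(a)$ is the unique root of $X^{q^m}-X$ in $\mathbb{Z}_p[\xi]$ whose residue class modulo $p$ is $a$. For a natural number $a$ let $S_p(a)$ be the sum of its base-$p$ digits, and for $\boldsymbol r=(r_1,\dots,r_k)$ put $|\boldsymbol r|=\sum_i r_i$. For a linear code $D\subseteq\mathbb{F}_q^n$, the $p$-adic valuation of $D$ is the greatest integer $t\ge 0$ such that $p^t$ divides the Hamming weight of every codeword of $D$ (it is $\infty$ if $D=0$). Theorem. Let $C\subseteq\mathbb{F}_{q^m}^n$ be a linear code with a generator matrix $G=(g_{ij})\in\mathbb{F}_{q^m}^{k\times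 n}$ (that is, the rows of $G$ span $C$), and let $$\mathrm{Tr}_{q^m/q}(C)=\{(\mathrm{Tr}_{q^m/q}(c_1),\dots,\mathrm{Tr}_{q^m/q}(c_n)) : (c_1,\dots,c_n)\in C\}\subseteq\mathbb{F}_q^n$$ be its trace code. Then the $p$-adic valuation of $\mathrm{Tr}_{q^m/q}(C)$ is equal to the minimum of $$\frac{1}{p-1}\sum_{i=1}^k S_p(r_i)+\nu_p\Bigl(\sum_{j=1}^n\prod_{i=1}^k T(g_{ij})^{r_i}\Bigr)-e$$ over all $\boldsymbol r\in\{0,1,\dots,q^m-1\}^k$ with $|\boldsymbol r|\equiv 0\pmod{q-1}$ and $|\boldsymbol r|>0$, where $0^0=1$. -/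

import Mathlib

open scoped Padic

noncomputable section

namespace TraceCode

/-! ### The `p`-adic side -/

section Padic

variable (p : ℕ) [Fact p.Prime]

/-- The `p`-adic valuation on `ℂ_p`, normalised by `ν_p(p) = 1` and with `ν_p(0) = ∞`:
`‖x‖ = p ^ (-ν_p(x))` for `x ≠ 0`. -/
def nu (x : ℂ_[p]) : EReal :=
  open Classical in if x = 0 then ⊤ else ((-Real.logb p ‖x‖ : ℝ) : EReal)

/-- The canonical map `ℤ_p → ℂ_p`. -/
def ofPadicInt : ℤ_[p] →+* ℂ_[p] :=
  (algebraMap ℚ_[p] ℂ_[p]).comp PadicInt.Coe.ringHom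

/-- The subring `ℤ_p[ξ]` of `ℂ_p`, i.e. all polynomial expressions in `ξ` over `ℤ_p`. -/
def adjoinInt (ξ : ℂ_[p]) : Subring ℂ_[p] :=
  (Polynomial.eval₂RingHom (ofPadicInt p) ξ).range

/-- The residue ring `ℤ_p[ξ] / (p)`. -/
abbrev ResidueRing (ξ : ℂ_[p]) : Type :=
  adjoinInt p ξ ⧸ Ideal.span {(p : adjoinInt p ξ)}

variable {p}

/-- The reduction map `ℤ_p[ξ] → ℤ_p[ξ] / (p) ≅ F`, for an identification `ι` of the residue ring
with the field `F`. -/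
def reduction {F : Type*} [Field F] {ξ : ℂ_[p]} (ι : ResidueRing p ξ ≃+* F) :
    adjoinInt p ξ →+* F :=
  (ι : ResidueRing p ξ →+* F).comp (Ideal.Quotient.mk _)

/-- The set `U` of all roots of `X ^ Q - X` in `ℤ_p[ξ]`. -/
def rootSet (ξ : ℂ_[p]) (Q : ℕ) : Set (adjoinInt p ξ) :=
  {u | u ^ Q = u}

/-- The Teichmüller lift `T : F → ℂ_p`: the inverse of the bijection `U → F` induced by reduction
modulo `p`, where `U` is the set of roots of `X ^ |F| - X` in `ℤ_p[ξ]`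
(see `reduction_bijOn` for the bijectivity). -/
def teichmullerLift {F : Type*} [Field F] {ξ : ℂ_[p]} (ι : ResidueRing p ξ ≃+* F) (a : F) :
    ℂ_[p] :=
  (Function.invFunOn (reduction ι) (rootSet ξ (Nat.card F)) a : adjoinInt p ξ)

end Padic

/-! ### The coding side -/

section Codes

/-- The trace code `Tr_{F/K}(C)`: the image of `C` under the coordinatewise trace. -/
def traceCode (K : Type*) {F : Type*} [Field K] [Field F] [Algebra K F] {n : ℕ}
    (C : Submodule F (Fin n → F)) : Submodule K (Fin n → K) :=
  (C.restrictScalars K).map ((Algebra.trace K F).compLeft (Fin n))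

/-- `G` is a generator matrix of `C`: its rows span `C`. -/
def IsGeneratorMatrix {F : Type*} [Field F] {k n : ℕ} (G : Matrix (Fin k) (Fin n) F)
    (C : Submodule F (Fin n → F)) : Prop :=
  Submodule.span F (Set.range G.row) = C

/-- A code is `Δ`-divisible if all its Hamming weights are multiples of `Δ`. -/
def IsDivisibleCode {K : Type*} [Field K] {n : ℕ} (C : Submodule K (Fin n → K)) (Δ : ℕ) : Prop :=
  open Classical in ∀ c ∈ C, Δ ∣ hammingNorm c

/-- The `p`-adic valuation of a code: the greatest `t` such that the code is `p ^ t`-divisible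
(`∞` if there is no greatest one, i.e. for the zero code). -/
def codeValuation (p : ℕ) {K : Type*} [Field K] {n : ℕ} (C : Submodule K (Fin n → K)) : EReal :=
  ⨆ (t : ℕ) (_ : IsDivisibleCode C (p ^ t)), ((t : ℝ) : EReal)

end Codes

/-- The sum of the base-`p` digits of `a`. -/
def digitSum (p a : ℕ) : ℕ := (Nat.digits p a).sum

/-! ### The residue ring is the field with `q ^ m` elements, and `T` is well defined -/

section WellDefined

variable {p : ℕ} [Fact p.Prime] {ξ : ℂ_[p]} {N : ℕ}

theorem norm_ofPadicInt (z : ℤ_[p]) : ‖ofPadicInt p z‖ = ‖z‖ := by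
  simp only [ofPadicInt, RingHom.comp_apply, norm_algebraMap']
  rfl

theorem norm_p_lt_one : ‖(p : ℂ_[p])‖ < 1 := by
  have h := norm_ofPadicInt (p := p) (p : ℤ_[p])
  rw [map_natCast] at h
  rw [h]
  rw [PadicInt.norm_p]
  exact inv_lt_one_of_one_lt₀ (by exact_mod_cast (Fact.out : p.Prime).one_lt)

theorem norm_natCast_le (a : ℕ) : ‖(a : ℂ_[p])‖ ≤ 1 := by
  have h := norm_ofPadicInt (p := p) (a : ℤ_[p])
  rw [map_natCast] at h
  rw [h]
  exact PadicInt.norm_le_one _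

theorem one_le_pow_sub (hN : N ≠ 0) : p ^ N - 1 ≠ 0 := by
  have := Nat.one_lt_pow hN (Fact.out : p.Prime).one_lt
  omega

theorem norm_le_one_of_mem (hN : N ≠ 0) (hξ : IsPrimitiveRoot ξ (p ^ N - 1))
    {x : ℂ_[p]} (hx : x ∈ adjoinInt p ξ) : ‖x‖ ≤ 1 := by
  obtain ⟨f, rfl⟩ := hx
  have h1 : ‖ξ‖ = 1 := by
    have h : ‖ξ‖ ^ (p ^ N - 1) = 1 := by rw [← norm_pow, hξ.pow_eq_one, norm_one]
    exact (pow_eq_one_iff_of_nonneg (norm_nonneg _) (one_le_pow_sub hN)).1 h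
  induction f using Polynomial.induction_on' with
  | add f g hf hg =>
    rw [map_add]
    exact (IsUltrametricDist.norm_add_le_max _ _).trans (max_le hf hg)
  | monomial a z =>
    simp only [Polynomial.coe_eval₂RingHom, Polynomial.eval₂_monomial, norm_mul, norm_pow, h1,
      one_pow, mul_one, norm_ofPadicInt]
    exact PadicInt.norm_le_one z

theorem natCast_residueRing : (p : ResidueRing p ξ) = 0 := by
  rw [← map_natCast (Ideal.Quotient.mk (Ideal.span {(p : adjoinInt p ξ)}))]
  exact Ideal.Quotient.eq_zero_iff_mem.2 (Ideal.mem_span_singleton_self _)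

theorem norm_lt_one_of_mk_eq_zero (hN : N ≠ 0) (hξ : IsPrimitiveRoot ξ (p ^ N - 1))
    {x : adjoinInt p ξ} (hx : (Ideal.Quotient.mk _ x : ResidueRing p ξ) = 0) :
    ‖(x : ℂ_[p])‖ < 1 := by
  obtain ⟨y, rfl⟩ := Ideal.mem_span_singleton.1 (Ideal.Quotient.eq_zero_iff_mem.1 hx)
  have hy := norm_le_one_of_mem hN hξ y.2
  have hp := norm_p_lt_one (p := p)
  simp only [Subring.coe_mul, Subring.coe_natCast, norm_mul]
  nlinarith [norm_nonneg (p : ℂ_[p]), norm_nonneg (y : ℂ_[p])]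

theorem residueRing_nontrivial (hN : N ≠ 0) (hξ : IsPrimitiveRoot ξ (p ^ N - 1)) :
    Nontrivial (ResidueRing p ξ) := by
  refine ⟨⟨1, 0, fun h => ?_⟩⟩
  have := norm_lt_one_of_mk_eq_zero hN hξ (x := 1) (by rw [map_one]; exact h)
  simp at this

theorem residueRing_charP (hN : N ≠ 0) (hξ : IsPrimitiveRoot ξ (p ^ N - 1)) :
    CharP (ResidueRing p ξ) p := by
  have := residueRing_nontrivial hN hξ
  have h : ringChar (ResidueRing p ξ) ∣ p := ringChar.dvd natCast_residueRing
  rcases (Nat.dvd_prime Fact.out).1 h with h | h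
  · exact absurd h CharP.ringChar_ne_one
  · exact ringChar.of_eq h

theorem residueRing_pow_card (hN : N ≠ 0) (hξ : IsPrimitiveRoot ξ (p ^ N - 1))
    (b : ResidueRing p ξ) : b ^ p ^ N = b := by
  have := residueRing_charP hN hξ
  have : ExpChar (ResidueRing p ξ) p := ExpChar.prime Fact.out
  obtain ⟨⟨_, f, rfl⟩, rfl⟩ := Ideal.Quotient.mk_surjective b
  let ρ : Polynomial ℤ_[p] →+* adjoinInt p ξ :=
    (Polynomial.eval₂RingHom (ofPadicInt p) ξ).rangeRestrict
  let g : Polynomial ℤ_[p] →+* ResidueRing p ξ := (Ideal.Quotient.mk _).comp ρ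
  have key : ∀ f : Polynomial ℤ_[p], iterateFrobenius _ p N (g f) = g f := by
    intro f
    induction f using Polynomial.induction_on' with
    | add f h hf hh => rw [map_add, map_add, hf, hh]
    | monomial a z =>
      rw [← Polynomial.C_mul_X_pow_eq_monomial, map_mul, map_mul, map_pow, map_pow]
      congr 1
      · obtain ⟨w, hw⟩ := Ideal.mem_span_singleton.1 (PadicInt.appr_spec 1 z)
        have hz : z = (p : ℤ_[p]) * w + (z.appr 1 : ℕ) := by
          rw [pow_one] at hw
          rw [← hw]; ring
        have h0 : g (Polynomial.C z) = ((z.appr 1 : ℕ) : ResidueRing p ξ) := by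
          conv_lhs => rw [hz]
          simp only [map_add, map_mul, map_natCast, natCast_residueRing, zero_mul, zero_add]
        rw [h0, map_natCast]
      · congr 1
        have hX : g Polynomial.X ^ (p ^ N - 1) = 1 := by
          rw [← map_pow]
          have : ρ (Polynomial.X ^ (p ^ N - 1)) = 1 := by
            apply Subtype.ext
            change Polynomial.eval₂ (ofPadicInt p) ξ (Polynomial.X ^ (p ^ N - 1)) = 1
            simp [hξ.pow_eq_one]
          change Ideal.Quotient.mk _ (ρ (Polynomial.X ^ (p ^ N - 1))) = 1
          rw [this, map_one]
        have hpos : p ^ N = (p ^ N - 1) + 1 := by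
          have := Nat.pow_pos (n := N) (Fact.out : p.Prime).pos
          omega
        rw [iterateFrobenius_def, hpos, pow_succ, hX, one_mul]
  exact key f

/-- `ℤ_p[ξ]` is compact, being spanned over `ℤ_p` by finitely many powers of `ξ`. -/
theorem isCompact_adjoinInt (hN : N ≠ 0) (hξ : IsPrimitiveRoot ξ (p ^ N - 1)) :
    IsCompact (adjoinInt p ξ : Set ℂ_[p]) := by
  let φ : (Fin (p ^ N - 1) → ℤ_[p]) → ℂ_[p] := fun c => ∑ i, ofPadicInt p (c i) * ξ ^ (i : ℕ)
  have hc : Continuous (ofPadicInt p) :=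
    (AddMonoidHomClass.isometry_of_norm (ofPadicInt p) norm_ofPadicInt).continuous
  have hφ : Continuous φ := by fun_prop
  have : (adjoinInt p ξ : Set ℂ_[p]) = Set.range φ := by
    apply Set.Subset.antisymm
    · rintro _ ⟨f, rfl⟩
      have hmon : (Polynomial.X ^ (p ^ N - 1) - 1 : Polynomial ℤ_[p]).Monic :=
        Polynomial.monic_X_pow_sub_C 1 (one_le_pow_sub hN)
      have hdeg : (f %ₘ (Polynomial.X ^ (p ^ N - 1) - 1)).natDegree < p ^ N - 1 := by
        have h1 : (Polynomial.X ^ (p ^ N - 1) - 1 : Polynomial ℤ_[p]).natDegree = p ^ N - 1 :=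
          Polynomial.natDegree_X_pow_sub_C (r := 1)
        have h2 := Polynomial.natDegree_modByMonic_lt f hmon (by
          intro h
          rw [h] at h1
          exact one_le_pow_sub (p := p) hN (by simpa using h1.symm))
        rwa [h1] at h2
      refine ⟨fun i => (f %ₘ (Polynomial.X ^ (p ^ N - 1) - 1)).coeff i, ?_⟩
      have h3 := Polynomial.modByMonic_add_div f (Polynomial.X ^ (p ^ N - 1) - 1)
      have h4 : Polynomial.eval₂ (ofPadicInt p) ξ f =
          Polynomial.eval₂ (ofPadicInt p) ξ (f %ₘ (Polynomial.X ^ (p ^ N - 1) - 1)) := by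
        conv_lhs => rw [← h3]
        simp [Polynomial.eval₂_add, Polynomial.eval₂_mul, hξ.pow_eq_one]
      rw [Polynomial.coe_eval₂RingHom, h4, Polynomial.eval₂_eq_sum_range' _ hdeg,
        ← Fin.sum_univ_eq_sum_range
          (fun i => ofPadicInt p ((f %ₘ (Polynomial.X ^ (p ^ N - 1) - 1)).coeff i) * ξ ^ i)]
    · rintro _ ⟨c, rfl⟩
      refine Subring.sum_mem _ fun i _ => Subring.mul_mem _ ?_ (Subring.pow_mem _ ?_ _)
      · exact ⟨Polynomial.C (c i), by simp⟩
      · exact ⟨Polynomial.X, by simp⟩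
  rw [this]
  exact isCompact_range hφ

/-- The elements of `ℤ_p[ξ]` of norm less than one are the multiples of `p`. -/
theorem mk_eq_zero_of_norm_lt_one (hN : N ≠ 0) (hξ : IsPrimitiveRoot ξ (p ^ N - 1))
    {x : adjoinInt p ξ} (hx : ‖(x : ℂ_[p])‖ < 1) :
    (Ideal.Quotient.mk _ x : ResidueRing p ξ) = 0 := by
  have hcl : IsClosed ((fun y : ℂ_[p] => (p : ℂ_[p]) * y) '' (adjoinInt p ξ : Set ℂ_[p])) :=
    ((isCompact_adjoinInt hN hξ).image (by fun_prop)).isClosed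
  have hmem : ∀ j : ℕ, (x : ℂ_[p]) - (x : ℂ_[p]) ^ (p ^ N) ^ j ∈
      (fun y : ℂ_[p] => (p : ℂ_[p]) * y) '' (adjoinInt p ξ : Set ℂ_[p]) := by
    intro j
    have h : ∀ b : ResidueRing p ξ, b ^ (p ^ N) ^ j = b := by
      intro b
      induction j with
      | zero => simp
      | succ j ih => rw [pow_succ, pow_mul, ih, residueRing_pow_card hN hξ]
    have h' : (Ideal.Quotient.mk _ (x - x ^ (p ^ N) ^ j) : ResidueRing p ξ) = 0 := by
      rw [map_sub, map_pow, h, sub_self]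
    obtain ⟨y, hy⟩ := Ideal.mem_span_singleton.1 (Ideal.Quotient.eq_zero_iff_mem.1 h')
    refine ⟨y, y.2, ?_⟩
    have := congrArg (Subtype.val) hy
    simpa using this.symm
  have h1 : 1 < p ^ N := Nat.one_lt_pow hN (Fact.out : p.Prime).one_lt
  have hlim : Filter.Tendsto (fun j : ℕ => (x : ℂ_[p]) - (x : ℂ_[p]) ^ (p ^ N) ^ j) Filter.atTop
      (nhds ((x : ℂ_[p]) - 0)) :=
    tendsto_const_nhds.sub
      ((tendsto_pow_atTop_nhds_zero_of_norm_lt_one hx).comp (tendsto_pow_atTop_atTop_of_one_lt h1))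
  obtain ⟨y, hy, hxy⟩ := hcl.mem_of_tendsto hlim (Filter.Eventually.of_forall hmem)
  rw [sub_zero] at hxy
  refine Ideal.Quotient.eq_zero_iff_mem.2 (Ideal.mem_span_singleton.2 ⟨⟨y, hy⟩, ?_⟩)
  apply Subtype.ext
  simpa using hxy.symm

theorem residueRing_isDomain (hN : N ≠ 0) (hξ : IsPrimitiveRoot ξ (p ^ N - 1)) :
    IsDomain (ResidueRing p ξ) := by
  have := residueRing_nontrivial hN hξ
  have : NoZeroDivisors (ResidueRing p ξ) := by
    refine ⟨fun {a b} hab => ?_⟩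
    obtain ⟨a, rfl⟩ := Ideal.Quotient.mk_surjective a
    obtain ⟨b, rfl⟩ := Ideal.Quotient.mk_surjective b
    rw [← map_mul] at hab
    have h := norm_lt_one_of_mk_eq_zero hN hξ hab
    rw [Subring.coe_mul, norm_mul] at h
    by_contra! hcon
    have ha : 1 ≤ ‖(a : ℂ_[p])‖ :=
      not_lt.1 fun h' => hcon.1 (mk_eq_zero_of_norm_lt_one hN hξ h')
    have hb : 1 ≤ ‖(b : ℂ_[p])‖ :=
      not_lt.1 fun h' => hcon.2 (mk_eq_zero_of_norm_lt_one hN hξ h')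
    nlinarith
  exact NoZeroDivisors.to_isDomain _

/-- Reduction modulo `p` is injective on the roots of `X ^ (p ^ N) - X`. -/
theorem mk_injOn_rootSet (hN : N ≠ 0) (hξ : IsPrimitiveRoot ξ (p ^ N - 1)) :
    Set.InjOn (fun u => (Ideal.Quotient.mk _ u : ResidueRing p ξ)) (rootSet ξ (p ^ N)) := by
  intro u hu v hv huv
  have hu' : u ^ p ^ N = u := hu
  have hv' : v ^ p ^ N = v := hv
  have hd : (Ideal.Quotient.mk _ (u - v) : ResidueRing p ξ) = 0 := by
    rw [map_sub]; exact sub_eq_zero.2 huv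
  obtain ⟨w, hw⟩ := Ideal.mem_span_singleton.1 (Ideal.Quotient.eq_zero_iff_mem.1 hd)
  by_contra hne
  -- `u ^ Q - v ^ Q = (u - v) * s` with `s ≡ Q * v ^ (Q - 1) ≡ 0`, whereas `s = 1`.
  have hs : (∑ i ∈ Finset.range (p ^ N), u ^ i * v ^ (p ^ N - 1 - i)) = 1 := by
    have h := (Commute.all u v).geom_sum₂_mul (p ^ N)
    rw [hu', hv'] at h
    exact mul_right_cancel₀ (sub_ne_zero.2 hne) (h.trans (one_mul _).symm)
  have := residueRing_nontrivial hN hξ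
  have h0 := congrArg (Ideal.Quotient.mk (Ideal.span {(p : adjoinInt p ξ)})) hs
  have huv' : (Ideal.Quotient.mk _ u : ResidueRing p ξ) = Ideal.Quotient.mk _ v := huv
  rw [map_sum, map_one] at h0
  simp only [map_mul, map_pow, huv'] at h0
  rw [Finset.sum_congr rfl (g := fun _ => (Ideal.Quotient.mk _ v : ResidueRing p ξ) ^ (p ^ N - 1))
    (fun i hi => by
      rw [← pow_add]
      congr 1
      have := Finset.mem_range.1 hi
      omega)] at h0
  rw [Finset.sum_const, Finset.card_range, nsmul_eq_mul, Nat.cast_pow, natCast_residueRing,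
    zero_pow hN, zero_mul] at h0
  exact zero_ne_one h0

theorem rootSet_ncard (hN : N ≠ 0) (hξ : IsPrimitiveRoot ξ (p ^ N - 1)) :
    ∃ f : Option (Fin (p ^ N - 1)) → adjoinInt p ξ,
      Function.Injective f ∧ ∀ i, f i ∈ rootSet ξ (p ^ N) := by
  let z : adjoinInt p ξ := ⟨ξ, Polynomial.X, by simp⟩
  have hz : IsPrimitiveRoot z (p ^ N - 1) :=
    IsPrimitiveRoot.of_map_of_injective (f := (adjoinInt p ξ).subtype) hξ Subtype.val_injective
  have hpos : p ^ N = (p ^ N - 1) + 1 := by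
    have := Nat.pow_pos (n := N) (Fact.out : p.Prime).pos
    omega
  have hz0 : z ≠ 0 := hz.ne_zero (one_le_pow_sub hN)
  refine ⟨fun i => i.elim 0 fun j => z ^ (j : ℕ), ?_, ?_⟩
  · rintro (_ | i) (_ | j) h
    · rfl
    · exact absurd h.symm (pow_ne_zero _ hz0)
    · exact absurd h (pow_ne_zero _ hz0)
    · exact congrArg some (Fin.ext (hz.pow_inj i.2 j.2 h))
  · rintro (_ | i)
    · change (0 : adjoinInt p ξ) ^ p ^ N = 0
      exact zero_pow (by omega)
    · change (z ^ (i : ℕ)) ^ p ^ N = z ^ (i : ℕ)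
      rw [← pow_mul, mul_comm, pow_mul]
      congr 1
      rw [hpos, pow_succ, hz.pow_eq_one, one_mul]

theorem finite_card_le_of_pow_eq (R : Type*) [CommRing R] [IsDomain R] {Q : ℕ} (hQ : 1 < Q)
    (h : ∀ b : R, b ^ Q = b) : Finite R ∧ Nat.card R ≤ Q := by
  classical
  have hdeg : (Polynomial.X ^ Q - Polynomial.X : Polynomial R).natDegree = Q := by
    have h1 : (Polynomial.X : Polynomial R).degree < (Polynomial.X ^ Q : Polynomial R).degree := by
      rw [Polynomial.degree_X_pow, Polynomial.degree_X]
      exact_mod_cast hQ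
    rw [Polynomial.natDegree_eq_of_degree_eq (Polynomial.degree_sub_eq_left_of_degree_lt h1),
      Polynomial.natDegree_X_pow]
  have hne : (Polynomial.X ^ Q - Polynomial.X : Polynomial R) ≠ 0 := by
    intro h0
    rw [h0, Polynomial.natDegree_zero] at hdeg
    omega
  have hroot : ∀ b : R, b ∈ (Polynomial.X ^ Q - Polynomial.X : Polynomial R).roots.toFinset := by
    intro b
    rw [Multiset.mem_toFinset, Polynomial.mem_roots hne]
    simp [h b]
  have hfin : Finite R :=
    Set.finite_univ_iff.1 ((Finset.finite_toSet _).subset fun b _ => hroot b)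
  refine ⟨hfin, ?_⟩
  have := Fintype.ofFinite R
  rw [Nat.card_eq_fintype_card, ← Finset.card_univ]
  calc _ ≤ _ := Finset.card_le_card fun b _ => hroot b
    _ ≤ _ := Multiset.toFinset_card_le _
    _ ≤ _ := Polynomial.card_roots' _
    _ = _ := hdeg

theorem residueRing_finite_card (hN : N ≠ 0) (hξ : IsPrimitiveRoot ξ (p ^ N - 1)) :
    Finite (ResidueRing p ξ) ∧ Nat.card (ResidueRing p ξ) = p ^ N := by
  have := residueRing_isDomain hN hξ
  obtain ⟨hfin, hle⟩ := finite_card_le_of_pow_eq (ResidueRing p ξ)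
    (Nat.one_lt_pow hN (Fact.out : p.Prime).one_lt) (residueRing_pow_card hN hξ)
  refine ⟨hfin, le_antisymm hle ?_⟩
  · obtain ⟨f, hf, hmem⟩ := rootSet_ncard hN hξ
    have hinj : Function.Injective fun i => (Ideal.Quotient.mk _ (f i) : ResidueRing p ξ) :=
      fun i j h => hf (mk_injOn_rootSet hN hξ (hmem i) (hmem j) h)
    have hcard : Nat.card (Option (Fin (p ^ N - 1))) ≤ Nat.card (ResidueRing p ξ) :=
      Nat.card_le_card_of_injective _ hinj
    rw [Nat.card_eq_fintype_card, Fintype.card_option, Fintype.card_fin] at hcard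
    exact le_trans (by omega) hcard

/-- The residue ring `ℤ_p[ξ] / (p)`, for `ξ` a primitive root of unity of order `|F| - 1`, can be
identified with the finite field `F`. -/
theorem nonempty_residueRing_equiv (F : Type*) [Field F] [Finite F] (hF : Nat.card F = p ^ N)
    (hξ : IsPrimitiveRoot ξ (p ^ N - 1)) : Nonempty (ResidueRing p ξ ≃+* F) := by
  have hN : N ≠ 0 := by
    rintro rfl
    have := Finite.one_lt_card (α := F)
    simp [hF] at this
  obtain ⟨hfin, hcard⟩ := residueRing_finite_card hN hξ
  have := residueRing_isDomain hN hξ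
  let _ : Field (ResidueRing p ξ) := (Finite.isDomain_to_isField _).toField
  have := Fintype.ofFinite (ResidueRing p ξ)
  have := Fintype.ofFinite F
  exact ⟨FiniteField.ringEquivOfCardEq
    (by rw [← Nat.card_eq_fintype_card, ← Nat.card_eq_fintype_card, hcard, hF])⟩

/-- Reduction modulo `p` is a bijection from the set of roots of `X ^ |F| - X` onto `F`; the
Teichmüller lift is its inverse. -/
theorem reduction_bijOn {F : Type*} [Field F] [Finite F] (hF : Nat.card F = p ^ N)
    (hξ : IsPrimitiveRoot ξ (p ^ N - 1)) (ι : ResidueRing p ξ ≃+* F) :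
    Set.BijOn (reduction ι) (rootSet ξ (Nat.card F)) Set.univ := by
  have hN : N ≠ 0 := by
    rintro rfl
    have := Finite.one_lt_card (α := F)
    simp [hF] at this
  rw [hF]
  have hinj : Set.InjOn (reduction ι) (rootSet ξ (p ^ N)) :=
    fun u hu v hv h => mk_injOn_rootSet hN hξ hu hv (ι.injective h)
  refine ⟨fun _ _ => Set.mem_univ _, hinj, ?_⟩
  obtain ⟨f, hf, hmem⟩ := rootSet_ncard hN hξ
  have hinj' : Function.Injective fun i => reduction ι (f i) :=
    fun i j h => hf (hinj (hmem i) (hmem j) h)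
  have hbij := (Nat.bijective_iff_injective_and_card _).2 ⟨hinj', by
    have : 0 < p ^ N := Nat.pow_pos (Fact.out : p.Prime).pos
    rw [hF, Nat.card_eq_fintype_card, Fintype.card_option, Fintype.card_fin]
    omega⟩
  intro a _
  obtain ⟨i, hi⟩ := hbij.2 a
  exact ⟨f i, hmem i, hi⟩

end WellDefined

end TraceCode

end

/-!
Let `Q = |F|` and let `ω : F → ℂ_p` be the Teichmüller character. The values of `ω` are the roots of
`X ^ Q - X`, so interpolation there writes the additive character `ψ = ζ ^ Tr` as a polynomial of
degree less than `Q` in `ω`. Its `r`-th coefficient is a Gauss sum up to a unit, and by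
Stickelberger's theorem it has norm `‖1 - ζ‖ ^ S_p(r)`. For a codeword `c = Tr (∑ i, a i * G i j)`,
summing `1 - ψ (b * c j)` over `b ∈ K` and all `j` gives `q * wt(c)`; expanding each term, and using
that the sum over `b` kills every monomial whose degree is not divisible by `q - 1`, makes
`q * wt(c)` a reduced polynomial in the `ω (a i)` whose coefficients have the valuations of the
theorem, shifted by `e`. The inverse of the Vandermonde matrix of the nodes `ω a` is integral, so
the largest norm of a value of this polynomial equals the largest norm of a coefficient.
-/

namespace TraceCode

section DigitSum

variable {b : ℕ}

theorem digitSum_zero : digitSum b 0 = 0 := by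
  simp [digitSum]

theorem digitSum_eq_mod_add_digitSum_div (hb : 1 < b) (a : ℕ) :
    digitSum b a = a % b + digitSum b (a / b) := by
  rcases Nat.eq_zero_or_pos a with rfl | ha
  · simp [digitSum]
  · simp [digitSum, Nat.digits_def' hb ha]

theorem digitSum_base_mul (hb : 1 < b) (a : ℕ) : digitSum b (b * a) = digitSum b a := by
  rw [digitSum_eq_mod_add_digitSum_div hb, Nat.mul_mod_right, zero_add,
    Nat.mul_div_cancel_left a (by omega)]

theorem digitSum_succ (hb : 1 < b) {a : ℕ} (ha : ¬ b ∣ a + 1) :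
    digitSum b (a + 1) = digitSum b a + 1 := by
  have hdiv := Nat.succ_div_of_not_dvd ha
  have ha₁ := Nat.div_add_mod a b
  have ha₂ := Nat.div_add_mod (a + 1) b
  rw [hdiv] at ha₂
  rw [digitSum_eq_mod_add_digitSum_div hb, digitSum_eq_mod_add_digitSum_div hb a, hdiv]
  omega

theorem digitSum_add_digitSum (hb : 1 < b) {N a c : ℕ} (h : a + c = b ^ N - 1) :
    digitSum b a + digitSum b c = (b - 1) * N := by
  induction N generalizing a c with
  | zero =>
    obtain ⟨rfl, rfl⟩ : a = 0 ∧ c = 0 := by simpa using h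
    simp [digitSum_zero]
  | succ N ih =>
    have ha := Nat.div_add_mod a b
    have hc := Nat.div_add_mod c b
    have ha' := Nat.mod_lt a (zero_lt_one.trans hb)
    have hc' := Nat.mod_lt c (zero_lt_one.trans hb)
    have htotal : b * (a / b + c / b) + (a % b + c % b + 1) = b * b ^ N := by
      have : 0 < b ^ (N + 1) := Nat.pow_pos (by omega)
      rw [← pow_succ', mul_add]
      omega
    have hmod : a % b + c % b + 1 = b :=
      Nat.eq_of_dvd_of_lt_two_mul (by omega)
        ((Nat.dvd_add_right (Dvd.intro _ rfl)).1 (htotal ▸ Dvd.intro _ rfl)) (by omega)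
    have hdiv : a / b + c / b + 1 = b ^ N :=
      Nat.eq_of_mul_eq_mul_left (zero_lt_one.trans hb) (by rw [← htotal, hmod, mul_add_one])
    rw [digitSum_eq_mod_add_digitSum_div hb a, digitSum_eq_mod_add_digitSum_div hb c, mul_add_one,
      ← ih (Nat.eq_sub_of_add_eq hdiv)]
    omega

end DigitSum

section Ultrametric

variable {L : Type*} [NormedField L]

theorem norm_eq_one_of_pow_eq_one {x : L} {n : ℕ} (hn : n ≠ 0) (hx : x ^ n = 1) : ‖x‖ = 1 :=
  (pow_eq_one_iff_of_nonneg (norm_nonneg x) hn).1 (by rw [← norm_pow, hx, norm_one])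

theorem norm_le_one_of_pow_eq_self {x : L} {n : ℕ} (hn : 1 < n) (hx : x ^ n = x) : ‖x‖ ≤ 1 := by
  rcases eq_or_ne x 0 with rfl | hx₀
  · simp
  · refine (norm_eq_one_of_pow_eq_one (n := n - 1) (by omega) ?_).le
    rwa [← mul_eq_right₀ hx₀, pow_sub_one_mul (by omega)]

variable [IsUltrametricDist L]

theorem norm_sub_one_eq_one {x : L} (hx : ‖x‖ < 1) : ‖x - 1‖ = 1 := by
  have hne : ‖x‖ ≠ ‖(-1 : L)‖ := by simpa using hx.ne
  rw [sub_eq_add_neg, IsUltrametricDist.norm_add_eq_max_of_norm_ne_norm hne, norm_neg, norm_one,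
    max_eq_right hx.le]

theorem norm_sub_le_one {x y : L} (hx : ‖x‖ ≤ 1) (hy : ‖y‖ ≤ 1) : ‖x - y‖ ≤ 1 := by
  rw [sub_eq_add_neg]
  exact (IsUltrametricDist.norm_add_le_max x (-y)).trans (max_le hx (by rwa [norm_neg]))

theorem norm_one_sub_pow_le {x : L} (hx : ‖x‖ ≤ 1) (i : ℕ) : ‖1 - x ^ i‖ ≤ ‖1 - x‖ := by
  have hgeom : ‖∑ j ∈ Finset.range i, x ^ j‖ ≤ 1 :=
    IsUltrametricDist.norm_sum_le_of_forall_le_of_nonneg zero_le_one fun j _ => by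
      rw [norm_pow]
      exact pow_le_one₀ (norm_nonneg x) hx
  rw [← mul_neg_geom_sum, norm_mul]
  exact mul_le_of_le_one_right (norm_nonneg _) hgeom

theorem norm_one_sub_pow_of_coprime {ζ : L} {n i : ℕ} [NeZero n] (hζ : IsPrimitiveRoot ζ n)
    (hi : i.Coprime n) : ‖1 - ζ ^ i‖ = ‖1 - ζ‖ := by
  have hnorm : ‖ζ‖ = 1 := norm_eq_one_of_pow_eq_one (NeZero.ne n) hζ.pow_eq_one
  obtain ⟨j, -, hj⟩ := (hζ.pow_of_coprime i hi).eq_pow_of_pow_eq_one hζ.pow_eq_one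
  refine le_antisymm (norm_one_sub_pow_le hnorm.le i) ?_
  calc ‖1 - ζ‖ = ‖1 - (ζ ^ i) ^ j‖ := by rw [hj]
    _ ≤ ‖1 - ζ ^ i‖ := norm_one_sub_pow_le (by rw [norm_pow, hnorm, one_pow]) j

theorem norm_one_sub_pow_pred {ζ : L} {p : ℕ} (hp : p.Prime) (hζ : IsPrimitiveRoot ζ p) :
    ‖1 - ζ‖ ^ (p - 1) = ‖(p : L)‖ := by
  obtain ⟨n, rfl⟩ : ∃ n, p = n + 1 := ⟨p - 1, (Nat.sub_add_cancel hp.one_le).symm⟩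
  have hconj : ∀ i ∈ Finset.range n, ‖1 - ζ ^ (i + 1)‖ = ‖1 - ζ‖ := fun i hi =>
    norm_one_sub_pow_of_coprime hζ
      (Nat.coprime_of_lt_prime i.succ_ne_zero (by simpa using hi) hp).symm
  rw [Nat.cast_add_one, ← hζ.prod_one_sub_pow_eq_order, norm_prod, Finset.prod_congr rfl hconj]
  simp

theorem norm_one_sub_lt_one {ζ : L} {p : ℕ} (hp : p.Prime) (hpL : ‖(p : L)‖ < 1)
    (hζ : IsPrimitiveRoot ζ p) : ‖1 - ζ‖ < 1 := by
  by_contra! hge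
  have := one_le_pow₀ hge (n := p - 1)
  rw [norm_one_sub_pow_pred hp hζ] at this
  exact hpL.not_ge this

theorem norm_pow_sub_linear_le {x : L} (hx : ‖x‖ ≤ 1) (a : ℕ) :
    ‖x ^ a - (1 - a * (1 - x))‖ ≤ ‖1 - x‖ ^ 2 := by
  induction a with
  | zero => simp
  | succ a ih =>
    have hrec : x ^ (a + 1) - (1 - (a + 1 : ℕ) * (1 - x)) =
        (x ^ a - (1 - a * (1 - x))) * x + a * (1 - x) ^ 2 := by
      push_cast
      ring
    rw [hrec]
    refine (IsUltrametricDist.norm_add_le_max _ _).trans (max_le ?_ ?_)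
    · rw [norm_mul]
      exact (mul_le_of_le_one_right (norm_nonneg _) hx).trans ih
    · rw [norm_mul, norm_pow]
      exact mul_le_of_le_one_left (by positivity) (IsUltrametricDist.norm_natCast_le_one L a)

end Ultrametric

section Characters

variable {F : Type*} [Field F]

theorem pow_eq_one_iff_card_sub_one_dvd {L : Type*} [Field L] [Fintype F] {ω : MulChar F L}
    (hω : Function.Injective ω) (r : ℕ) : ω ^ r = 1 ↔ Fintype.card F - 1 ∣ r := by
  rw [← FiniteField.forall_pow_eq_one_iff, MulChar.ext_iff]
  refine forall_congr' fun x => ?_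
  rw [MulChar.pow_apply_coe, MulChar.one_apply_coe, ← map_pow, ← map_one ω, hω.eq_iff,
    Units.ext_iff, Units.val_pow_eq_pow_val, Units.val_one]

variable {L : Type*} [NormedField L]

theorem norm_mulChar_le_one [Finite F] (χ : MulChar F L) (x : F) : ‖χ x‖ ≤ 1 := by
  have := Fintype.ofFinite F
  rcases eq_or_ne x 0 with rfl | hx
  · rw [MulChar.map_zero, norm_zero]
    exact zero_le_one
  · refine (norm_eq_one_of_pow_eq_one (n := Fintype.card F - 1) ?_ ?_).le
    · have := Fintype.one_lt_card (α := F)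
      omega
    · rw [← map_pow, FiniteField.pow_card_sub_one_eq_one x hx, map_one]

variable [Fintype F]

theorem norm_jacobiSum_le_one [IsUltrametricDist L] (χ φ : MulChar F L) :
    ‖jacobiSum χ φ‖ ≤ 1 := by
  refine IsUltrametricDist.norm_sum_le_of_forall_le_of_nonneg zero_le_one fun x _ => ?_
  rw [norm_mul]
  exact mul_le_one₀ (norm_mulChar_le_one χ x) (norm_nonneg _) (norm_mulChar_le_one φ _)

theorem norm_sum_mulChar_mul_le [IsUltrametricDist L] (χ : MulChar F L)
    {f : F → L} {B : ℝ} (hB : 0 ≤ B) (hf : ∀ x, ‖f x‖ ≤ B) : ‖∑ x, χ x * f x‖ ≤ B :=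
  IsUltrametricDist.norm_sum_le_of_forall_le_of_nonneg hB fun x _ => by
    rw [norm_mul]
    exact (mul_le_of_le_one_left (norm_nonneg _) (norm_mulChar_le_one χ x)).trans (hf x)

/-- The values of `ω` are representatives of the elements of `F` in the residue field of `L`:
every integral relation between them that holds modulo the maximal ideal holds in `F`. Stated this
way, the notion needs no identification of `F` with a subfield of the residue field. -/
def IsMultiplicativeLift (ω : MulChar F L) : Prop :=
  ∀ z : F → ℤ, ‖∑ x, (z x : L) * ω x‖ < 1 → ∑ x, (z x : F) * x = 0

theorem IsMultiplicativeLift.injective {ω : MulChar F L} (hω : IsMultiplicativeLift ω) :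
    Function.Injective ω := by
  classical
  intro x y hxy
  have h := hω (fun a => (if a = x then 1 else 0) - (if a = y then 1 else 0)) (by
    simp [sub_mul, Finset.sum_sub_distrib, hxy])
  simpa [sub_mul, Finset.sum_sub_distrib, sub_eq_zero] using h

end Characters

section GaussSums

variable {F L : Type*} [Field F] [Fintype F] [NormedField L]

theorem norm_gaussSum_mul_norm_gaussSum_inv {χ : MulChar F L}
    (hχ : χ ≠ 1) {ψ : AddChar F L} (hψ : ψ.IsPrimitive) :
    ‖gaussSum χ ψ‖ * ‖gaussSum χ⁻¹ ψ‖ = ‖(Fintype.card F : L)‖ := by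
  have hsign : ‖χ⁻¹ (-1)‖ = 1 :=
    norm_eq_one_of_pow_eq_one two_ne_zero (by rw [← map_pow, neg_one_sq, map_one])
  rw [← mul_gaussSum_inv_eq_gaussSum χ⁻¹, norm_mul, hsign, one_mul, ← norm_mul,
    gaussSum_mul_gaussSum_eq_card hχ hψ]

theorem norm_gaussSum_mul_le {χ φ : MulChar F L} [IsUltrametricDist L] (hχφ : χ * φ ≠ 1)
    (ψ : AddChar F L) : ‖gaussSum χ ψ‖ * ‖gaussSum φ ψ‖ ≤ ‖gaussSum (χ * φ) ψ‖ := by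
  rw [← norm_mul, ← jacobiSum_mul_nontrivial hχφ, norm_mul]
  exact mul_le_of_le_one_right (norm_nonneg _) (norm_jacobiSum_le_one χ φ)

end GaussSums

section TraceCharacter

theorem sum_inv_mul_trace (K F : Type*) [Field K] [Field F] [Fintype F] [Algebra K F] :
    ∑ x : F, x⁻¹ * algebraMap K F (Algebra.trace K F x) = -1 := by
  classical
  have : Finite K := Finite.of_injective _ (algebraMap K F).injective
  have hK : 1 < Nat.card K := Finite.one_lt_card
  obtain ⟨d, hd⟩ : ∃ d, Module.finrank K F = d + 1 :=
    ⟨_, (Nat.succ_pred_eq_of_pos Module.finrank_pos).symm⟩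
  have hF : Fintype.card F = Nat.card K ^ (d + 1) := by
    rw [← Nat.card_eq_fintype_card, Module.natCard_eq_pow_finrank (K := K), hd]
  have hlinear : ∑ x : F, x⁻¹ * x ^ Nat.card K ^ 0 = -1 := by
    have (x : F) : x⁻¹ * x ^ Nat.card K ^ 0 = 1 - if x = 0 then 1 else 0 := by
      by_cases hx : x = 0 <;> simp [hx]
    simp only [this, Finset.sum_sub_distrib, Finset.sum_ite_eq', Finset.mem_univ, if_true]
    simp
  have hfrob : ∀ i ∈ Finset.range d, ∑ x : F, x⁻¹ * x ^ Nat.card K ^ (i + 1) = 0 := by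
    intro i hi
    have hone : 1 < Nat.card K ^ (i + 1) := Nat.one_lt_pow i.succ_ne_zero hK
    have hlt : Nat.card K ^ (i + 1) < Nat.card K ^ (d + 1) :=
      Nat.pow_lt_pow_right hK (by simpa using hi)
    rw [← FiniteField.sum_pow_lt_card_sub_one F (Nat.card K ^ (i + 1) - 1) (by omega)]
    refine Finset.sum_congr rfl fun x _ => ?_
    rcases eq_or_ne x 0 with rfl | hx
    · rw [inv_zero, zero_mul, zero_pow (by omega)]
    · rw [inv_mul_eq_iff_eq_mul₀ hx, mul_pow_sub_one (by omega)]
  simp_rw [FiniteField.algebraMap_trace_eq_sum_pow, Finset.mul_sum, hd]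
  rw [Finset.sum_comm, Finset.sum_range_succ', Finset.sum_eq_zero hfrob, zero_add, hlinear]

variable {p : ℕ} [Fact p.Prime] {F L : Type*} [Field F] [Algebra (ZMod p) F]

/-- The additive character `x ↦ ζ ^ Tr x` of a finite field `F` of characteristic `p`, for a `p`-th
root of unity `ζ`. -/
noncomputable def traceChar [CommRing L] (F : Type*) [Field F] [Algebra (ZMod p) F] {ζ : L}
    (hζ : ζ ^ p = 1) : AddChar F L :=
  (AddChar.zmodChar p hζ).compAddMonoidHom (Algebra.trace (ZMod p) F).toAddMonoidHom

theorem traceChar_apply [CommRing L] {ζ : L} (hζ : ζ ^ p = 1) (x : F) :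
    traceChar F hζ x = ζ ^ (Algebra.trace (ZMod p) F x).val := rfl

theorem traceChar_ne_one [CommRing L] [Finite F] {ζ : L} (hζ : IsPrimitiveRoot ζ p) :
    traceChar F hζ.pow_eq_one ≠ 1 := by
  obtain ⟨x, hx⟩ := Algebra.trace_surjective (ZMod p) F 1
  refine AddChar.ne_one_iff.2 ⟨x, ?_⟩
  have : Fact (1 < p) := ⟨(Fact.out : p.Prime).one_lt⟩
  rw [traceChar_apply, hx, ZMod.val_one, pow_one]
  exact hζ.ne_one this.out

theorem traceChar_trace [CommRing L] [Finite F] {K : Type*} [Field K] [Algebra K F]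
    [Algebra (ZMod p) K] [IsScalarTower (ZMod p) K F] {ζ : L} (hζ : ζ ^ p = 1) (y : F) :
    traceChar K hζ (Algebra.trace K F y) = traceChar F hζ y := by
  have : Finite K := Finite.of_injective _ (algebraMap K F).injective
  rw [traceChar_apply, traceChar_apply, Algebra.trace_trace]

theorem traceChar_pow [CommRing L] [Finite F] {ζ : L} (hζ : ζ ^ p = 1) (x : F) :
    traceChar F hζ (x ^ p) = traceChar F hζ x := by
  have h := Algebra.trace_eq_of_algEquiv (FiniteField.frobeniusAlgEquivOfAlgebraic (ZMod p) F) x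
  rw [FiniteField.coe_frobeniusAlgEquivOfAlgebraic, ZMod.card] at h
  rw [traceChar_apply, traceChar_apply, h]

variable [Fintype F]

theorem card_eq_pow_finrank_zmod (p : ℕ) [Fact p.Prime] [Algebra (ZMod p) F] :
    Fintype.card F = p ^ Module.finrank (ZMod p) F := by
  rw [Module.card_eq_pow_finrank (K := ZMod p), ZMod.card]

theorem norm_card_lt_one [NormedField L] (hpL : ‖(p : L)‖ < 1) : ‖(Fintype.card F : L)‖ < 1 := by
  rw [card_eq_pow_finrank_zmod (F := F) p, Nat.cast_pow, norm_pow]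
  exact pow_lt_one₀ (norm_nonneg _) hpL Module.finrank_pos.ne'

theorem gaussSum_pow_char [CommRing L] {ζ : L} (hζ : ζ ^ p = 1) (χ : MulChar F L) :
    gaussSum (χ ^ p) (traceChar F hζ) = gaussSum χ (traceChar F hζ) := by
  rw [gaussSum, gaussSum,
    ← (FiniteField.frobeniusAlgEquivOfAlgebraic (ZMod p) F).toEquiv.sum_comp
      fun y => χ y * traceChar F hζ y]
  refine Finset.sum_congr rfl fun x _ => ?_
  rw [AlgEquiv.toEquiv_eq_coe, AlgEquiv.coe_toEquiv, FiniteField.coe_frobeniusAlgEquivOfAlgebraic,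
    ZMod.card, traceChar_pow, map_pow, MulChar.pow_apply' _ (NeZero.ne p)]

end TraceCharacter

section Stickelberger

variable {p : ℕ} [Fact p.Prime] {F L : Type*} [Field F] [Algebra (ZMod p) F] [Fintype F]
  [NormedField L] {ω : MulChar F L} {ζ : L}

theorem one_le_norm_sum_inv_mul_trace (hω : IsMultiplicativeLift ω) :
    1 ≤ ‖∑ x, ω⁻¹ x * (Algebra.trace (ZMod p) F x).val‖ := by
  by_contra! hlt
  rw [← Equiv.sum_comp (Equiv.inv F)] at hlt
  have hrel := hω (fun x => (Algebra.trace (ZMod p) F x⁻¹).val) <| by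
    simpa only [MulChar.inv_apply', Equiv.inv_apply, inv_inv, mul_comm, Int.cast_natCast] using hlt
  have hsum := sum_inv_mul_trace (ZMod p) F
  rw [← Equiv.sum_comp (Equiv.inv F)] at hsum
  refine neg_ne_zero.2 one_ne_zero (hsum.symm.trans (Eq.trans ?_ hrel))
  refine Finset.sum_congr rfl fun x _ => ?_
  rw [Equiv.inv_apply, inv_inv, Int.cast_natCast, ← map_natCast (algebraMap (ZMod p) F),
    ZMod.natCast_zmod_val, mul_comm]

variable [IsUltrametricDist L]

theorem norm_one_sub_le_norm_gaussSum_inv (hpL : ‖(p : L)‖ < 1) (hω : IsMultiplicativeLift ω)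
    (hω₁ : ω ≠ 1) (hζ : IsPrimitiveRoot ζ p) :
    ‖1 - ζ‖ ≤ ‖gaussSum ω⁻¹ (traceChar F hζ.pow_eq_one)‖ := by
  have hp : p.Prime := Fact.out
  set S := ∑ x, ω⁻¹ x * ((Algebra.trace (ZMod p) F x).val : L) with hS
  set g := gaussSum ω⁻¹ (traceChar F hζ.pow_eq_one) with hg
  have hlinear : ‖g + (1 - ζ) * S‖ ≤ ‖1 - ζ‖ ^ 2 := by
    have hζ₁ : ‖ζ‖ ≤ 1 := (norm_eq_one_of_pow_eq_one hp.ne_zero hζ.pow_eq_one).le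
    have hsplit : g + (1 - ζ) * S = ∑ x, ω⁻¹ x * (ζ ^ (Algebra.trace (ZMod p) F x).val -
        (1 - (Algebra.trace (ZMod p) F x).val * (1 - ζ))) := by
      rw [hg, hS, gaussSum, Finset.mul_sum, ← sub_eq_zero, ← Finset.sum_add_distrib,
        ← Finset.sum_sub_distrib, ← MulChar.sum_eq_zero_of_ne_one (inv_ne_one.2 hω₁)]
      refine Finset.sum_congr rfl fun x _ => ?_
      rw [traceChar_apply]
      ring
    rw [hsplit]
    exact norm_sum_mulChar_mul_le _ (by positivity) fun x => norm_pow_sub_linear_le hζ₁ _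
  have hS₁ : ‖1 - ζ‖ ≤ ‖(1 - ζ) * S‖ := by
    rw [norm_mul]
    exact le_mul_of_one_le_right (norm_nonneg _) (one_le_norm_sum_inv_mul_trace hω)
  have hpos : 0 < ‖1 - ζ‖ := norm_pos_iff.2 (sub_ne_zero.2 (hζ.ne_one hp.one_lt).symm)
  have hsq : ‖1 - ζ‖ ^ 2 < ‖1 - ζ‖ :=
    pow_lt_self_of_lt_one₀ hpos (norm_one_sub_lt_one hp hpL hζ) one_lt_two
  have hnorm : ‖g‖ = ‖(1 - ζ) * S‖ := IsUltrametricDist.norm_eq_of_add_norm_lt_max <|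
    (hlinear.trans_lt hsq).trans_le (hS₁.trans (le_max_right _ _))
  rwa [hnorm]

theorem norm_one_sub_pow_digitSum_le (hpL : ‖(p : L)‖ < 1) (hω : IsMultiplicativeLift ω)
    (hζ : IsPrimitiveRoot ζ p) {r : ℕ} (hr : r < Fintype.card F - 1) :
    ‖1 - ζ‖ ^ digitSum p r ≤ ‖gaussSum (ω⁻¹ ^ r) (traceChar F hζ.pow_eq_one)‖ := by
  have hp : 1 < p := (Fact.out : p.Prime).one_lt
  have hpow_ne_one {s : ℕ} (hs : s ≠ 0) (hs' : s < Fintype.card F - 1) : ω ^ s ≠ 1 := by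
    rw [ne_eq, pow_eq_one_iff_card_sub_one_dvd hω.injective]
    exact Nat.not_dvd_of_pos_of_lt (Nat.pos_of_ne_zero hs) hs'
  induction r using Nat.strong_induction_on with
  | _ r ih =>
    rcases eq_or_ne r 0 with rfl | hr₀
    · rw [pow_zero, gaussSum_one_left (traceChar_ne_one hζ), digitSum_zero, pow_zero, norm_neg,
        norm_one]
    by_cases hdvd : p ∣ r
    · obtain ⟨s, rfl⟩ := hdvd
      have hs : s < p * s := by nlinarith [Nat.pos_of_ne_zero (right_ne_zero_of_mul hr₀)]
      rw [digitSum_base_mul hp, mul_comm, pow_mul, gaussSum_pow_char]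
      exact ih s hs (hs.trans hr)
    · obtain ⟨s, rfl⟩ := Nat.exists_eq_succ_of_ne_zero hr₀
      have hne : ω⁻¹ * ω⁻¹ ^ s ≠ 1 := by
        rw [← pow_succ', inv_pow, inv_ne_one]
        exact hpow_ne_one hr₀ hr
      have hω₁ : ω ≠ 1 := by simpa using hpow_ne_one one_ne_zero (by omega)
      calc ‖1 - ζ‖ ^ digitSum p (s + 1) = ‖1 - ζ‖ * ‖1 - ζ‖ ^ digitSum p s := by
            rw [digitSum_succ hp hdvd, pow_succ']
        _ ≤ ‖gaussSum ω⁻¹ _‖ * ‖gaussSum (ω⁻¹ ^ s) _‖ :=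
            mul_le_mul (norm_one_sub_le_norm_gaussSum_inv hpL hω hω₁ hζ)
              (ih s s.lt_succ_self (by omega)) (by positivity) (norm_nonneg _)
        _ ≤ ‖gaussSum (ω⁻¹ ^ (s + 1)) _‖ := by
            rw [pow_succ']
            exact norm_gaussSum_mul_le hne _

/-- **Stickelberger's theorem** on the valuation of Gauss sums. -/
theorem norm_gaussSum_inv_pow (hpL : ‖(p : L)‖ < 1) (hω : IsMultiplicativeLift ω)
    (hζ : IsPrimitiveRoot ζ p) {r : ℕ} (hr : r < Fintype.card F - 1) :
    ‖gaussSum (ω⁻¹ ^ r) (traceChar F hζ.pow_eq_one)‖ = ‖1 - ζ‖ ^ digitSum p r := by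
  have hp : p.Prime := Fact.out
  rcases eq_or_ne r 0 with rfl | hr₀
  · rw [pow_zero, gaussSum_one_left (traceChar_ne_one hζ), digitSum_zero, pow_zero, norm_neg,
      norm_one]
  obtain ⟨s, hs⟩ := Nat.exists_eq_add_of_lt hr
  have hne : ω⁻¹ ^ r ≠ 1 := by
    rw [inv_pow, ne_eq, inv_eq_one, pow_eq_one_iff_card_sub_one_dvd hω.injective]
    exact Nat.not_dvd_of_pos_of_lt (Nat.pos_of_ne_zero hr₀) hr
  have hinv : (ω⁻¹ ^ r)⁻¹ = ω⁻¹ ^ (s + 1) := by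
    rw [inv_eq_iff_mul_eq_one, ← pow_add, inv_pow, inv_eq_one,
      pow_eq_one_iff_card_sub_one_dvd hω.injective, hs, add_assoc]
  have hcard : Fintype.card F = p ^ Module.finrank (ZMod p) F := card_eq_pow_finrank_zmod p
  -- The lower bounds for `r` and `s + 1` have product `‖card F‖`, so both are attained.
  have hprod := norm_gaussSum_mul_norm_gaussSum_inv hne
    (AddChar.IsPrimitive.of_ne_one (traceChar_ne_one (F := F) hζ))
  rw [hinv, hcard, Nat.cast_pow, norm_pow, ← norm_one_sub_pow_pred hp hζ, ← pow_mul,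
    ← digitSum_add_digitSum hp.one_lt (a := r) (c := s + 1) (by omega), pow_add ‖1 - ζ‖] at hprod
  have hpos : 0 < ‖1 - ζ‖ := norm_pos_iff.2 (sub_ne_zero.2 (hζ.ne_one hp.one_lt).symm)
  have hle := norm_one_sub_pow_digitSum_le hpL hω hζ hr
  have hle' := norm_one_sub_pow_digitSum_le hpL hω hζ (r := s + 1) (by omega)
  exact ((mul_eq_mul_iff_eq_and_eq_of_pos hle hle' (pow_pos hpos _)
    ((pow_pos hpos _).trans_le hle')).1 hprod.symm).1.symm

end Stickelberger

section Interpolation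

variable {α L : Type*} [Fintype α] [NormedField L]

/-- The coefficient of `X ^ r` in the Lagrange basis polynomial at `t a` for nodes `t` that are the
roots of `X ^ Q - X`, where `Q` is the number of nodes. This polynomial is the quotient of
`(X ^ Q - X) / (X - t a) = ∑ r < Q, t a ^ (Q - 1 - r) * X ^ r - 1` by its value at `t a`. -/
noncomputable def lagrangeCoeff (t : α → L) (r : ℕ) (a : α) : L :=
  (t a ^ (Fintype.card α - 1 - r) - if r = 0 then 1 else 0) /
    (Fintype.card α * t a ^ (Fintype.card α - 1) - 1)

variable {t : α → L}

theorem one_lt_card_of_norm_card_lt_one (hQ : ‖(Fintype.card α : L)‖ < 1) (a : α) :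
    1 < Fintype.card α := by
  have hpos : 0 < Fintype.card α := Fintype.card_pos_iff.2 ⟨a⟩
  refine lt_of_le_of_ne hpos fun h => ?_
  rw [← h, Nat.cast_one, norm_one] at hQ
  exact hQ.false

theorem norm_root_le_one (hQ : ‖(Fintype.card α : L)‖ < 1)
    (hroot : ∀ a, t a ^ Fintype.card α = t a) (a : α) : ‖t a‖ ≤ 1 :=
  norm_le_one_of_pow_eq_self (one_lt_card_of_norm_card_lt_one hQ a) (hroot a)

variable [IsUltrametricDist L]

theorem norm_card_mul_pow_sub_one (hQ : ‖(Fintype.card α : L)‖ < 1)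
    (hroot : ∀ a, t a ^ Fintype.card α = t a) (a : α) :
    ‖(Fintype.card α : L) * t a ^ (Fintype.card α - 1) - 1‖ = 1 := by
  have hx : ‖t a‖ ≤ 1 := norm_root_le_one hQ hroot a
  refine norm_sub_one_eq_one ?_
  rw [norm_mul, norm_pow]
  exact mul_lt_one_of_nonneg_of_lt_one_left (norm_nonneg _) hQ
    (pow_le_one₀ (norm_nonneg _) hx)

theorem norm_lagrangeCoeff_le_one (hQ : ‖(Fintype.card α : L)‖ < 1)
    (hroot : ∀ a, t a ^ Fintype.card α = t a) (r : ℕ) (a : α) : ‖lagrangeCoeff t r a‖ ≤ 1 := by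
  rw [lagrangeCoeff, norm_div, norm_card_mul_pow_sub_one hQ hroot, div_one]
  refine norm_sub_le_one ?_ (by split_ifs <;> simp)
  rw [norm_pow]
  exact pow_le_one₀ (norm_nonneg _) (norm_root_le_one hQ hroot a)

theorem sum_pow_mul_lagrangeCoeff [DecidableEq α] (hQ : ‖(Fintype.card α : L)‖ < 1)
    (hroot : ∀ a, t a ^ Fintype.card α = t a) (ht : Function.Injective t) (a b : α) :
    ∑ r ∈ Finset.range (Fintype.card α), t b ^ r * lagrangeCoeff t r a =
      if b = a then 1 else 0 := by
  set Q := Fintype.card α with hQ_def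
  have hne : (Q : L) * t a ^ (Q - 1) - 1 ≠ 0 :=
    norm_ne_zero_iff.1 (by rw [norm_card_mul_pow_sub_one hQ hroot]; exact one_ne_zero)
  have hnum : ∑ r ∈ Finset.range Q, t b ^ r * lagrangeCoeff t r a =
      ((∑ r ∈ Finset.range Q, t b ^ r * t a ^ (Q - 1 - r)) - 1) / (Q * t a ^ (Q - 1) - 1) := by
    have hpos : 0 < Q := Fintype.card_pos_iff.2 ⟨a⟩
    simp [lagrangeCoeff, ← hQ_def, mul_div_assoc', ← Finset.sum_div, mul_sub,
      Finset.sum_sub_distrib, hpos]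
  rw [hnum]
  split_ifs with hba
  · have hpow : ∀ r ∈ Finset.range Q, t a ^ r * t a ^ (Q - 1 - r) = t a ^ (Q - 1) := fun r hr => by
      rw [← pow_add, Nat.add_sub_cancel' (Nat.le_sub_one_of_lt (Finset.mem_range.1 hr))]
    rw [hba, Finset.sum_congr rfl hpow, Finset.sum_const, Finset.card_range, nsmul_eq_mul,
      div_self hne]
  · have hsub : t b - t a ≠ 0 := sub_ne_zero.2 (ht.ne hba)
    have hgeom := (Commute.all (t b) (t a)).geom_sum₂_mul Q
    rw [hroot, hroot] at hgeom
    rw [mul_right_cancel₀ hsub (hgeom.trans (one_mul _).symm), sub_self, zero_div]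

theorem sum_lagrangeCoeff_mul_pow (hQ : ‖(Fintype.card α : L)‖ < 1)
    (hroot : ∀ a, t a ^ Fintype.card α = t a) (ht : Function.Injective t) {r s : ℕ}
    (hr : r < Fintype.card α) (hs : s < Fintype.card α) :
    ∑ a, lagrangeCoeff t r a * t a ^ s = if r = s then 1 else 0 := by
  classical
  let V : Matrix α (Fin (Fintype.card α)) L := .of fun b r => t b ^ (r : ℕ)
  let D : Matrix (Fin (Fintype.card α)) α L := .of fun r a => lagrangeCoeff t r a
  have hVD : V * D = 1 := by
    ext b a
    simp only [V, D, Matrix.mul_apply, Matrix.of_apply, Matrix.one_apply]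
    rw [← sum_pow_mul_lagrangeCoeff hQ hroot ht a b, Finset.sum_range]
  have hDV : D * V = 1 := (Matrix.mul_eq_one_comm_of_card_eq _ _ _ (Fintype.card_fin _).symm).1 hVD
  simpa [V, D, Matrix.mul_apply, Matrix.one_apply] using congr_fun₂ hDV ⟨r, hr⟩ ⟨s, hs⟩

theorem eq_sum_lagrangeCoeff_mul_pow (hQ : ‖(Fintype.card α : L)‖ < 1)
    (hroot : ∀ a, t a ^ Fintype.card α = t a) (ht : Function.Injective t) (f : α → L) (b : α) :
    f b = ∑ r ∈ Finset.range (Fintype.card α), (∑ a, lagrangeCoeff t r a * f a) * t b ^ r := by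
  classical
  calc f b = ∑ a, (if b = a then 1 else 0) * f a := by simp
    _ = ∑ a, ∑ r ∈ Finset.range (Fintype.card α), lagrangeCoeff t r a * f a * t b ^ r := by
        refine Finset.sum_congr rfl fun a _ => ?_
        rw [← sum_pow_mul_lagrangeCoeff hQ hroot ht, Finset.sum_mul]
        exact Finset.sum_congr rfl fun r _ => by ring
    _ = _ := by
        rw [Finset.sum_comm]
        simp only [Finset.sum_mul]

variable {ι : Type*} [Fintype ι]

theorem sum_prod_lagrangeCoeff_mul_prod_pow [DecidableEq ι] (hQ : ‖(Fintype.card α : L)‖ < 1)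
    (hroot : ∀ a, t a ^ Fintype.card α = t a) (ht : Function.Injective t) {r s : ι → ℕ}
    (hr : ∀ i, r i < Fintype.card α) (hs : ∀ i, s i < Fintype.card α) :
    ∑ a : ι → α, (∏ i, lagrangeCoeff t (r i) (a i)) * ∏ i, t (a i) ^ s i =
      if r = s then 1 else 0 := by
  classical
  simp only [← Finset.prod_mul_distrib]
  rw [← Fintype.prod_sum fun i a => lagrangeCoeff t (r i) a * t a ^ s i]
  simp only [sum_lagrangeCoeff_mul_pow hQ hroot ht (hr _) (hs _), Finset.prod_ite_zero,
    Finset.prod_const_one, Finset.mem_univ, true_imp_iff, funext_iff]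

theorem norm_coeff_le (hQ : ‖(Fintype.card α : L)‖ < 1) (hroot : ∀ a, t a ^ Fintype.card α = t a)
    (ht : Function.Injective t) {R : Finset (ι → ℕ)} (hR : ∀ r ∈ R, ∀ i, r i < Fintype.card α)
    {c : (ι → ℕ) → L} {B : ℝ} (hB : ∀ a : ι → α, ‖∑ s ∈ R, c s * ∏ i, t (a i) ^ s i‖ ≤ B)
    {r : ι → ℕ} (hr : r ∈ R) : ‖c r‖ ≤ B := by
  classical
  have hc : c r = ∑ a : ι → α, (∏ i, lagrangeCoeff t (r i) (a i)) *
      ∑ s ∈ R, c s * ∏ i, t (a i) ^ s i := by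
    simp only [Finset.mul_sum, mul_left_comm _ (c _)]
    rw [Finset.sum_comm]
    rw [Finset.sum_congr rfl fun s hs => by
      rw [← Finset.mul_sum, sum_prod_lagrangeCoeff_mul_prod_pow hQ hroot ht (hR r hr) (hR s hs)]]
    simp [hr]
  have hα (i : ι) : Nonempty α := Fintype.card_pos_iff.1 ((Nat.zero_le _).trans_lt (hR r hr i))
  have hB₀ : 0 ≤ B := (norm_nonneg _).trans (hB fun i => Classical.choice (hα i))
  rw [hc]
  refine IsUltrametricDist.norm_sum_le_of_forall_le_of_nonneg hB₀ fun a _ => ?_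
  rw [norm_mul, norm_prod]
  refine (mul_le_of_le_one_left (norm_nonneg _) ?_).trans (hB a)
  exact Finset.prod_le_one (fun _ _ => norm_nonneg _) fun i _ =>
    norm_lagrangeCoeff_le_one hQ hroot _ _

end Interpolation

section CharacterExpansion

variable {F L : Type*} [Field F] [Fintype F] [NormedField L]

/-- The coefficient of `X ^ r` in the polynomial of degree less than `card F` that takes the value
`ψ a` at `ω a` for every `a : F`. -/
noncomputable def charCoeff (ω : MulChar F L) (ψ : AddChar F L) (r : ℕ) : L :=
  ∑ a, lagrangeCoeff ω r a * ψ a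

theorem mulChar_pow_card (ω : MulChar F L) (a : F) : ω a ^ Fintype.card F = ω a := by
  rw [← map_pow, FiniteField.pow_card]

theorem charCoeff_eq_gaussSum {ω : MulChar F L} (ψ : AddChar F L) {r : ℕ} (hr₀ : r ≠ 0)
    (hr : r < Fintype.card F - 1) :
    charCoeff ω ψ r = gaussSum (ω⁻¹ ^ r) ψ / ((Fintype.card F : L) - 1) := by
  classical
  have hinv : ω ^ (Fintype.card F - 1 - r) = ω⁻¹ ^ r := by
    rw [inv_pow, eq_inv_iff_mul_eq_one, ← pow_add, Nat.sub_add_cancel hr.le,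
      ← Fintype.card_units, MulChar.pow_card_eq_one]
  rw [charCoeff, gaussSum, Finset.sum_div]
  refine Finset.sum_congr rfl fun a _ => ?_
  rw [← hinv, MulChar.pow_apply' _ (by omega), lagrangeCoeff, if_neg hr₀, sub_zero,
    div_mul_eq_mul_div]
  rcases eq_or_ne a 0 with rfl | ha
  · rw [MulChar.map_zero, zero_pow (by omega)]
    simp
  · rw [← map_pow _ a (_ - 1), FiniteField.pow_card_sub_one_eq_one a ha, map_one, mul_one]

theorem charCoeff_card_sub_one (hF : (Fintype.card F : L) ≠ 1) (ω : MulChar F L) {ψ : AddChar F L}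
    (hψ : ψ ≠ 1) :
    charCoeff ω ψ (Fintype.card F - 1) = -(Fintype.card F / ((Fintype.card F : L) - 1)) := by
  classical
  have hcard := Fintype.one_lt_card (α := F)
  have hne : (Fintype.card F : L) - 1 ≠ 0 := sub_ne_zero.2 hF
  have hcoeff (a : F) : lagrangeCoeff ω (Fintype.card F - 1) a =
      1 / ((Fintype.card F : L) - 1) -
        if a = 0 then Fintype.card F / ((Fintype.card F : L) - 1) else 0 := by
    rw [lagrangeCoeff, Nat.sub_self, pow_zero, if_neg (by omega), sub_zero, ← map_pow]
    split_ifs with ha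
    · rw [ha, zero_pow (by omega), MulChar.map_zero]
      field_simp
      ring
    · rw [FiniteField.pow_card_sub_one_eq_one a ha, map_one, mul_one, sub_zero]
  simp only [charCoeff, hcoeff, sub_mul, Finset.sum_sub_distrib, ← Finset.mul_sum, ite_mul,
    zero_mul, Finset.sum_ite_eq', Finset.mem_univ, if_true]
  rw [AddChar.sum_eq_zero_of_ne_one hψ, AddChar.map_zero_eq_one, mul_zero, mul_one, zero_sub]

variable [IsUltrametricDist L] {ω : MulChar F L}

theorem addChar_eq_sum_charCoeff (hQ : ‖(Fintype.card F : L)‖ < 1) (hω : Function.Injective ω)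
    (ψ : AddChar F L) (y : F) :
    ψ y = ∑ r ∈ Finset.range (Fintype.card F), charCoeff ω ψ r * ω y ^ r :=
  eq_sum_lagrangeCoeff_mul_pow hQ (mulChar_pow_card ω) hω ψ y

theorem charCoeff_zero (hQ : ‖(Fintype.card F : L)‖ < 1) (hω : Function.Injective ω)
    (ψ : AddChar F L) : charCoeff ω ψ 0 = 1 := by
  have h := addChar_eq_sum_charCoeff hQ hω ψ 0
  rw [AddChar.map_zero_eq_one, MulChar.map_zero, Finset.sum_eq_single_of_mem 0
    (Finset.mem_range.2 Fintype.card_pos) fun r _ hr => by rw [zero_pow hr, mul_zero]] at h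
  simpa using h.symm

theorem addChar_sum_eq_sum_prod_charCoeff {ι : Type*} [Fintype ι] [DecidableEq ι]
    (hQ : ‖(Fintype.card F : L)‖ < 1) (hω : Function.Injective ω) (ψ : AddChar F L) (y : ι → F) :
    ψ (∑ i, y i) = ∑ r ∈ Fintype.piFinset fun _ : ι => Finset.range (Fintype.card F),
      (∏ i, charCoeff ω ψ (r i)) * ∏ i, ω (y i) ^ r i := by
  have hprod : ψ (∑ i, y i) = ∏ i, ψ (y i) :=
    map_prod ψ.toMonoidHom (fun i => Multiplicative.ofAdd (y i)) Finset.univ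
  simp only [hprod, addChar_eq_sum_charCoeff hQ hω ψ (y _), Finset.prod_univ_sum,
    Finset.prod_mul_distrib]

theorem norm_charCoeff {p : ℕ} [Fact p.Prime] [Algebra (ZMod p) F] {ζ : L}
    (hpL : ‖(p : L)‖ < 1) (hω : IsMultiplicativeLift ω) (hζ : IsPrimitiveRoot ζ p) {r : ℕ}
    (hr : r < Fintype.card F) :
    ‖charCoeff ω (traceChar F hζ.pow_eq_one) r‖ = ‖1 - ζ‖ ^ digitSum p r := by
  have hp : p.Prime := Fact.out
  have hcard : Fintype.card F = p ^ Module.finrank (ZMod p) F := card_eq_pow_finrank_zmod p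
  have hQ : ‖(Fintype.card F : L)‖ < 1 := norm_card_lt_one hpL
  rcases eq_or_ne r 0 with rfl | hr₀
  · rw [charCoeff_zero hQ hω.injective, norm_one, digitSum_zero, pow_zero]
  rcases (Nat.le_sub_one_of_lt hr).eq_or_lt with rfl | hr
  · have hdigits : digitSum p (Fintype.card F - 1) = (p - 1) * Module.finrank (ZMod p) F := by
      simpa [digitSum_zero] using digitSum_add_digitSum hp.one_lt (c := 0)
        (show Fintype.card F - 1 + 0 = _ - 1 by rw [add_zero, ← hcard])
    rw [charCoeff_card_sub_one (fun h => by simp [h] at hQ) ω (traceChar_ne_one hζ), norm_neg,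
      norm_div, norm_sub_one_eq_one hQ, div_one, hdigits, pow_mul, norm_one_sub_pow_pred hp hζ,
      hcard, Nat.cast_pow, norm_pow]
  · rw [charCoeff_eq_gaussSum _ hr₀ hr, norm_div, norm_sub_one_eq_one hQ, div_one,
      norm_gaussSum_inv_pow hpL hω hζ hr]

end CharacterExpansion

section WeightFormula

variable {K F L : Type*} [Field K] [Field F] [Algebra K F] [Field L]

/-- The restriction of a multiplicative character of `F` to a subfield `K`. -/
noncomputable def restrictMulChar (K : Type*) [Field K] [Algebra K F] (ω : MulChar F L) :
    MulChar K L :=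
  MulChar.ofUnitHom (ω.toUnitHom.comp (Units.map (algebraMap K F)))

theorem restrictMulChar_apply (ω : MulChar F L) (b : K) :
    restrictMulChar K ω b = ω (algebraMap K F b) := by
  rcases eq_or_ne b 0 with rfl | hb
  · simp only [map_zero, MulChar.map_zero]
  · lift b to Kˣ using hb.isUnit
    rw [restrictMulChar, MulChar.ofUnitHom_coe]
    rfl

variable [Fintype K]

theorem sum_pow_restrictMulChar {ω : MulChar F L} (hω : Function.Injective ω) {s : ℕ}
    (hs : s ≠ 0) :
    ∑ b : K, ω (algebraMap K F b) ^ s =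
      if Fintype.card K - 1 ∣ s then (Fintype.card K : L) - 1 else 0 := by
  classical
  have hinj : Function.Injective (restrictMulChar K ω) := fun a b hab =>
    (algebraMap K F).injective (hω (by simpa only [restrictMulChar_apply] using hab))
  simp only [← restrictMulChar_apply, ← MulChar.pow_apply' _ hs]
  split_ifs with hdvd
  · rw [(pow_eq_one_iff_card_sub_one_dvd hinj s).2 hdvd, MulChar.sum_one_eq_card_units,
      Fintype.card_units, Nat.cast_pred Fintype.card_pos]
  · exact MulChar.sum_eq_zero_of_ne_one ((pow_eq_one_iff_card_sub_one_dvd hinj s).not.2 hdvd)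

theorem sum_one_sub_addChar_eq_card_mul_hammingNorm [DecidableEq K] {n : Type*} [Fintype n]
    {ψ : AddChar K L} (hψ : ψ.IsPrimitive) (c : n → K) :
    ∑ j, ∑ b, (1 - ψ (b * c j)) = (Fintype.card K * hammingNorm c : L) := by
  have hcoord (j : n) :
      ∑ b, (1 - ψ (b * c j)) = (Fintype.card K : L) * if c j ≠ 0 then 1 else 0 := by
    rw [Finset.sum_sub_distrib, AddChar.sum_mulShift _ hψ]
    split_ifs <;> simp_all
  simp only [hcoord, ← Finset.mul_sum, Finset.sum_boole, hammingNorm]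

end WeightFormula

section WeightPolynomial

variable {ι n K F L : Type*} [Fintype ι] [Fintype n] [Field K] [Fintype K] [Field F] [Fintype F]
  [Algebra K F] [NormedField L]

/-- The exponents of the monomials in `weightCoeff`: reduced modulo `X ^ Q - X` in each variable,
nonzero, and of total degree divisible by `q - 1`. -/
def weightExponents (ι : Type*) [Fintype ι] [DecidableEq ι] (q Q : ℕ) : Finset (ι → ℕ) :=
  {r ∈ Fintype.piFinset fun _ => Finset.range Q | 0 < ∑ i, r i ∧ q - 1 ∣ ∑ i, r i}

theorem mem_weightExponents [DecidableEq ι] {q Q : ℕ} {r : ι → ℕ} :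
    r ∈ weightExponents ι q Q ↔ (∀ i, r i < Q) ∧ 0 < ∑ i, r i ∧ q - 1 ∣ ∑ i, r i := by
  simp [weightExponents]

theorem weightExponents_nonempty [DecidableEq ι] [Nonempty ι] {q Q : ℕ} (hQ : 1 < Q)
    (hdvd : q - 1 ∣ Q - 1) : (weightExponents ι q Q).Nonempty := by
  refine ⟨fun _ => Q - 1, mem_weightExponents.2 ⟨fun _ => by omega, ?_, ?_⟩⟩
  · rw [Finset.sum_const, smul_eq_mul]
    exact Nat.mul_pos Fintype.card_pos (by omega)
  · exact Finset.dvd_sum fun _ _ => hdvd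

/-- Up to the factor `-q / (q - 1)`, the coefficients of the weight of the codeword
`Tr (∑ i, a i * G i j)`, viewed as a reduced polynomial in the values `ω (a i)`. -/
noncomputable def weightCoeff (ω : MulChar F L) (ψ : AddChar F L) (G : Matrix ι n F) (r : ι → ℕ) :
    L :=
  (∏ i, charCoeff ω ψ (r i)) * ∑ j, ∏ i, ω (G i j) ^ r i

variable [IsUltrametricDist L] [DecidableEq ι] {ω : MulChar F L}

theorem one_sub_addChar_sum_eq (hQ : ‖(Fintype.card F : L)‖ < 1) (hω : Function.Injective ω)
    (ψ : AddChar F L) (y : ι → F) :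
    1 - ψ (∑ i, y i) =
      -∑ r ∈ Fintype.piFinset fun _ : ι => Finset.range (Fintype.card F) with 0 < ∑ i, r i,
        (∏ i, charCoeff ω ψ (r i)) * ∏ i, ω (y i) ^ r i := by
  have hzero : {r ∈ Fintype.piFinset fun _ : ι => Finset.range (Fintype.card F) |
      ¬ 0 < ∑ i, r i} = {0} := by
    ext r
    simp only [Finset.mem_filter, Fintype.mem_piFinset, Finset.mem_range, not_lt,
      nonpos_iff_eq_zero, Finset.sum_eq_zero_iff, Finset.mem_univ, true_imp_iff,
      Finset.mem_singleton, funext_iff, Pi.zero_apply, and_iff_right_iff_imp]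
    exact fun h i => by rw [h i]; exact Fintype.card_pos
  rw [addChar_sum_eq_sum_prod_charCoeff hQ hω, ← Finset.sum_filter_add_sum_filter_not _
    (fun r : ι → ℕ => 0 < ∑ i, r i), hzero, Finset.sum_singleton]
  simp [charCoeff_zero hQ hω]

theorem sum_weightCoeff_mul_prod_pow [DecidableEq K] (hQ : ‖(Fintype.card F : L)‖ < 1)
    (hω : Function.Injective ω) {φ : AddChar K L} (hφ : φ.IsPrimitive) {ψ : AddChar F L}
    (hψ : ∀ y, ψ y = φ (Algebra.trace K F y)) (G : Matrix ι n F) (a : ι → F) :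
    ((Fintype.card K : L) - 1) * ∑ r ∈ weightExponents ι (Fintype.card K) (Fintype.card F),
        weightCoeff ω ψ G r * ∏ i, ω (a i) ^ r i =
      -(Fintype.card K * hammingNorm fun j => Algebra.trace K F (∑ i, a i * G i j)) := by
  have htrace (b : K) (y : F) :
      φ (b * Algebra.trace K F y) = ψ (algebraMap K F b * y) := by
    rw [hψ, ← Algebra.smul_def, map_smul, smul_eq_mul]
  have hexpand (j : n) (b : K) : 1 - ψ (algebraMap K F b * ∑ i, a i * G i j) =
      -∑ r ∈ Fintype.piFinset fun _ : ι => Finset.range (Fintype.card F) with 0 < ∑ i, r i,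
        (∏ i, charCoeff ω ψ (r i)) * (∏ i, ω (a i) ^ r i) * (∏ i, ω (G i j) ^ r i) *
          ω (algebraMap K F b) ^ ∑ i, r i := by
    rw [Finset.mul_sum, one_sub_addChar_sum_eq hQ hω]
    refine congrArg _ (Finset.sum_congr rfl fun r _ => ?_)
    simp only [map_mul, mul_pow, Finset.prod_mul_distrib, Finset.prod_pow_eq_pow_sum]
    ring
  rw [← sum_one_sub_addChar_eq_card_mul_hammingNorm hφ]
  simp only [htrace, hexpand, Finset.sum_neg_distrib, neg_neg]
  rw [Finset.sum_comm_cycle, weightExponents, ← Finset.filter_filter, Finset.sum_filter,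
    Finset.mul_sum]
  refine Finset.sum_congr rfl fun r hr => ?_
  simp only [← Finset.mul_sum]
  rw [sum_pow_restrictMulChar hω (Finset.mem_filter.1 hr).2.ne', weightCoeff, ← Finset.sum_mul,
    ← Finset.mul_sum]
  split_ifs <;> ring

end WeightPolynomial

section WeightCoefficients

variable {p : ℕ} [Fact p.Prime] {ι n K F L : Type*} [Fintype ι] [Fintype n] [Field K] [Fintype K]
  [Field F] [Fintype F] [Algebra K F] [Algebra (ZMod p) K] [Algebra (ZMod p) F]
  [IsScalarTower (ZMod p) K F] [NormedField L] [IsUltrametricDist L] {ω : MulChar F L} {ζ : L}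

theorem norm_weightCoeff (hpL : ‖(p : L)‖ < 1) (hω : IsMultiplicativeLift ω)
    (hζ : IsPrimitiveRoot ζ p) (G : Matrix ι n F) {r : ι → ℕ} (hr : ∀ i, r i < Fintype.card F) :
    ‖weightCoeff ω (traceChar F hζ.pow_eq_one) G r‖ =
      ‖1 - ζ‖ ^ (∑ i, digitSum p (r i)) * ‖∑ j, ∏ i, ω (G i j) ^ r i‖ := by
  rw [weightCoeff, norm_mul, norm_prod, ← Finset.prod_pow_eq_pow_sum]
  simp only [norm_charCoeff hpL hω hζ (hr _)]

variable [DecidableEq ι] [DecidableEq K]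

theorem norm_sum_weightCoeff_mul_prod_pow (hpL : ‖(p : L)‖ < 1) (hω : Function.Injective ω)
    (hζ : IsPrimitiveRoot ζ p) (G : Matrix ι n F) (a : ι → F) :
    ‖∑ r ∈ weightExponents ι (Fintype.card K) (Fintype.card F),
        weightCoeff ω (traceChar F hζ.pow_eq_one) G r * ∏ i, ω (a i) ^ r i‖ =
      ‖(Fintype.card K : L)‖ *
        ‖(hammingNorm fun j => Algebra.trace K F (∑ i, a i * G i j) : L)‖ := by
  have h := congrArg norm <| sum_weightCoeff_mul_prod_pow (norm_card_lt_one (p := p) hpL) hω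
    (AddChar.IsPrimitive.of_ne_one (traceChar_ne_one (F := K) hζ))
    (fun y => (traceChar_trace hζ.pow_eq_one y).symm) G a
  rwa [norm_mul, norm_sub_one_eq_one (norm_card_lt_one (p := p) hpL), one_mul, norm_neg,
    norm_mul] at h

theorem norm_weightCoeff_le (hpL : ‖(p : L)‖ < 1) (hω : Function.Injective ω)
    (hζ : IsPrimitiveRoot ζ p) (G : Matrix ι n F) {B : ℝ}
    (hB : ∀ a : ι → F,
      ‖(hammingNorm fun j => Algebra.trace K F (∑ i, a i * G i j) : L)‖ ≤ B)
    {r : ι → ℕ} (hr : r ∈ weightExponents ι (Fintype.card K) (Fintype.card F)) :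
    ‖weightCoeff ω (traceChar F hζ.pow_eq_one) G r‖ ≤ ‖(Fintype.card K : L)‖ * B := by
  refine norm_coeff_le (norm_card_lt_one (p := p) hpL) (mulChar_pow_card ω) hω
    (fun s hs => (mem_weightExponents.1 hs).1) (fun a => ?_) hr
  rw [norm_sum_weightCoeff_mul_prod_pow hpL hω hζ]
  exact mul_le_mul_of_nonneg_left (hB a) (norm_nonneg _)

theorem exists_norm_hammingNorm_le_norm_weightCoeff [Nonempty ι] (hpL : ‖(p : L)‖ < 1)
    (hω : Function.Injective ω) (hζ : IsPrimitiveRoot ζ p) (G : Matrix ι n F) (a : ι → F) :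
    ∃ r ∈ weightExponents ι (Fintype.card K) (Fintype.card F),
      ‖(Fintype.card K : L)‖ *
          ‖(hammingNorm fun j => Algebra.trace K F (∑ i, a i * G i j) : L)‖ ≤
        ‖weightCoeff ω (traceChar F hζ.pow_eq_one) G r‖ := by
  have hdvd : Fintype.card K - 1 ∣ Fintype.card F - 1 := by
    rw [Module.card_eq_pow_finrank (K := K) (V := F)]
    simpa using Nat.sub_dvd_pow_sub_pow (Fintype.card K) 1 (Module.finrank K F)
  obtain ⟨r, hr, hle⟩ := IsUltrametricDist.exists_norm_finsetSum_le_of_nonempty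
    (weightExponents_nonempty (ι := ι) Fintype.one_lt_card hdvd)
    fun r => weightCoeff ω (traceChar F hζ.pow_eq_one) G r * ∏ i, ω (a i) ^ r i
  rw [norm_sum_weightCoeff_mul_prod_pow hpL hω hζ, norm_mul, norm_prod] at hle
  refine ⟨r, hr, hle.trans (mul_le_of_le_one_right (norm_nonneg _) ?_)⟩
  refine Finset.prod_le_one (fun _ _ => norm_nonneg _) fun i _ => ?_
  rw [norm_pow]
  exact pow_le_one₀ (norm_nonneg _) (norm_mulChar_le_one ω _)

end WeightCoefficients

section Teichmuller

variable {p : ℕ} [Fact p.Prime] {ξ : ℂ_[p]} {N : ℕ} {F : Type*} [Field F] [Finite F]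

theorem exists_teichmullerLift_eq (hF : Nat.card F = p ^ N)
    (hξ : IsPrimitiveRoot ξ (p ^ N - 1)) (ι : ResidueRing p ξ ≃+* F) (a : F) :
    ∃ u ∈ rootSet ξ (Nat.card F), reduction ι u = a ∧ (u : ℂ_[p]) = teichmullerLift ι a := by
  have h : ∃ u ∈ rootSet ξ (Nat.card F), reduction ι u = a :=
    (reduction_bijOn hF hξ ι).surjOn (Set.mem_univ a)
  exact ⟨_, Function.invFunOn_mem h, Function.invFunOn_eq h, rfl⟩

theorem teichmullerLift_reduction (hF : Nat.card F = p ^ N)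
    (hξ : IsPrimitiveRoot ξ (p ^ N - 1)) (ι : ResidueRing p ξ ≃+* F) {u : adjoinInt p ξ}
    (hu : u ∈ rootSet ξ (Nat.card F)) : teichmullerLift ι (reduction ι u) = u := by
  obtain ⟨v, hv, hvu, h⟩ := exists_teichmullerLift_eq hF hξ ι (reduction ι u)
  rw [← h, (reduction_bijOn hF hξ ι).injOn hv hu hvu]

/-- The Teichmüller lift as a multiplicative character of `F`. -/
noncomputable def teichmullerChar (hF : Nat.card F = p ^ N) (hξ : IsPrimitiveRoot ξ (p ^ N - 1))
    (ι : ResidueRing p ξ ≃+* F) : MulChar F ℂ_[p] where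
  toFun := teichmullerLift ι
  map_one' := by
    have h := teichmullerLift_reduction hF hξ ι (u := 1) (one_pow _)
    rwa [map_one] at h
  map_mul' a b := by
    obtain ⟨u, hu, rfl, hua⟩ := exists_teichmullerLift_eq hF hξ ι a
    obtain ⟨v, hv, rfl, hvb⟩ := exists_teichmullerLift_eq hF hξ ι b
    have huv : u * v ∈ rootSet ξ (Nat.card F) :=
      (mul_pow u v _).trans (congrArg₂ _ hu hv)
    rw [← map_mul, teichmullerLift_reduction hF hξ ι huv, ← hua, ← hvb, Subring.coe_mul]
  map_nonunit' a ha := by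
    have h := teichmullerLift_reduction hF hξ ι (u := 0) (zero_pow Nat.card_pos.ne')
    rwa [map_zero, ← not_ne_iff.1 (isUnit_iff_ne_zero.not.1 ha)] at h

theorem teichmullerChar_apply (hF : Nat.card F = p ^ N) (hξ : IsPrimitiveRoot ξ (p ^ N - 1))
    (ι : ResidueRing p ξ ≃+* F) (a : F) : teichmullerChar hF hξ ι a = teichmullerLift ι a := rfl

theorem isMultiplicativeLift_teichmullerChar [Fintype F] (hF : Nat.card F = p ^ N)
    (hξ : IsPrimitiveRoot ξ (p ^ N - 1)) (ι : ResidueRing p ξ ≃+* F) :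
    IsMultiplicativeLift (teichmullerChar hF hξ ι) := by
  have hN : N ≠ 0 := by
    rintro rfl
    exact (Finite.one_lt_card (α := F)).ne' (by rw [hF, pow_zero])
  intro z hz
  choose u _ hred hu using exists_teichmullerLift_eq hF hξ ι
  have hsum : ((∑ x, (z x : adjoinInt p ξ) * u x : adjoinInt p ξ) : ℂ_[p]) =
      ∑ x, (z x : ℂ_[p]) * teichmullerChar hF hξ ι x := by
    rw [AddSubmonoidClass.coe_finsetSum]
    refine Finset.sum_congr rfl fun x _ => ?_
    rw [Subring.coe_mul, Subring.coe_intCast, hu, teichmullerChar_apply]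
  rw [← hsum] at hz
  have h : reduction ι (∑ x, (z x : adjoinInt p ξ) * u x) = 0 := by
    rw [reduction, RingHom.comp_apply, mk_eq_zero_of_norm_lt_one hN hξ hz, map_zero]
  simpa only [map_sum, map_mul, map_intCast, hred] using h

end Teichmuller

section Valuation

variable {p : ℕ} [Fact p.Prime]

theorem nu_zero : nu p 0 = ⊤ := if_pos rfl

theorem nu_of_ne_zero {x : ℂ_[p]} (hx : x ≠ 0) : nu p x = ((-Real.logb p ‖x‖ : ℝ) : EReal) :=
  if_neg hx

theorem nu_ne_bot (x : ℂ_[p]) : nu p x ≠ ⊥ := by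
  rcases eq_or_ne x 0 with rfl | hx
  · rw [nu_zero]
    exact top_ne_bot
  · rw [nu_of_ne_zero hx]
    exact EReal.coe_ne_bot _

theorem nu_le_nu {x y : ℂ_[p]} (h : ‖x‖ ≤ ‖y‖) : nu p y ≤ nu p x := by
  rcases eq_or_ne x 0 with rfl | hx
  · rw [nu_zero]
    exact le_top
  · have hy : y ≠ 0 := norm_pos_iff.1 ((norm_pos_iff.2 hx).trans_le h)
    rw [nu_of_ne_zero hx, nu_of_ne_zero hy, EReal.coe_le_coe_iff, neg_le_neg_iff]
    exact Real.logb_le_logb_of_le (Nat.one_lt_cast.2 (Fact.out : p.Prime).one_lt)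
      (norm_pos_iff.2 hx) h

theorem nu_mul (x y : ℂ_[p]) : nu p (x * y) = nu p x + nu p y := by
  rcases eq_or_ne x 0 with rfl | hx
  · rw [zero_mul, nu_zero, EReal.top_add_of_ne_bot (nu_ne_bot y)]
  rcases eq_or_ne y 0 with rfl | hy
  · rw [mul_zero, nu_zero, nu_of_ne_zero hx, EReal.coe_add_top]
  · rw [nu_of_ne_zero hx, nu_of_ne_zero hy, nu_of_ne_zero (mul_ne_zero hx hy), ← EReal.coe_add,
      norm_mul, Real.logb_mul (norm_ne_zero_iff.2 hx) (norm_ne_zero_iff.2 hy), neg_add]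

theorem norm_natCast_eq_zpow {a : ℕ} (ha : a ≠ 0) :
    ‖(a : ℂ_[p])‖ = (p : ℝ) ^ (-padicValNat p a : ℤ) := by
  rw [← map_natCast (ofPadicInt p), norm_ofPadicInt, ← PadicInt.padic_norm_e_of_padicInt,
    PadicInt.coe_natCast, Padic.norm_eq_zpow_neg_valuation (Nat.cast_ne_zero.2 ha),
    Padic.valuation_natCast]

theorem nu_natCast {a : ℕ} (ha : a ≠ 0) : nu p a = ((padicValNat p a : ℝ) : EReal) := by
  have hp : 1 < (p : ℝ) := Nat.one_lt_cast.2 (Fact.out : p.Prime).one_lt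
  rw [nu_of_ne_zero (Nat.cast_ne_zero.2 ha), norm_natCast_eq_zpow ha, ← Real.rpow_intCast,
    Real.logb_rpow (zero_lt_one.trans hp) hp.ne', Int.cast_neg, neg_neg, Int.cast_natCast]

theorem natCast_le_nu_natCast_iff {t a : ℕ} :
    ((t : ℝ) : EReal) ≤ nu p a ↔ p ^ t ∣ a := by
  rcases eq_or_ne a 0 with rfl | ha
  · simp [nu_zero]
  · rw [nu_natCast ha, EReal.coe_le_coe_iff, Nat.cast_le, padicValNat_dvd_iff_le ha]

theorem iSup_pow_dvd_eq_nu (a : ℕ) :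
    ⨆ (t : ℕ) (_ : p ^ t ∣ a), ((t : ℝ) : EReal) = nu p a := by
  refine le_antisymm (iSup₂_le fun t => natCast_le_nu_natCast_iff.2) ?_
  rcases eq_or_ne a 0 with rfl | ha
  · rw [Nat.cast_zero, nu_zero]
    refine ((EReal.eq_top_iff_forall_lt _).2 fun y => ?_).ge
    obtain ⟨t, ht⟩ := exists_nat_gt y
    exact (EReal.coe_lt_coe_iff.2 ht).trans_le (le_iSup₂_of_le t (dvd_zero _) le_rfl)
  · rw [nu_natCast ha]
    exact le_iSup₂_of_le (padicValNat p a) pow_padicValNat_dvd le_rfl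

theorem nu_div_prime_pow (x : ℂ_[p]) (e : ℕ) :
    nu p (x / (p : ℂ_[p]) ^ e) = nu p x - ((e : ℝ) : EReal) := by
  have hp : p ^ e ≠ 0 := pow_ne_zero e (NeZero.ne p)
  have hnu : nu p ((p : ℂ_[p]) ^ e) = ((e : ℝ) : EReal) := by
    rw [← Nat.cast_pow, nu_natCast hp, padicValNat.prime_pow]
  have hmul := nu_mul (x / (p : ℂ_[p]) ^ e) ((p : ℂ_[p]) ^ e)
  rw [div_mul_cancel₀ x (by exact_mod_cast hp), hnu] at hmul
  rw [hmul, EReal.add_sub_cancel_right]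

theorem nu_one_sub_pow {ζ : ℂ_[p]} (hζ : IsPrimitiveRoot ζ p) (s : ℕ) :
    nu p ((1 - ζ) ^ s) = ((1 / ((p : ℝ) - 1) * s : ℝ) : EReal) := by
  have hp : p.Prime := Fact.out
  have hp₁ : (0 : ℝ) < p - 1 := sub_pos.2 (Nat.one_lt_cast.2 hp.one_lt)
  have hlogb : ((p : ℝ) - 1) * Real.logb p ‖1 - ζ‖ = -1 := by
    rw [← Nat.cast_pred hp.pos, ← Real.logb_pow, norm_one_sub_pow_pred hp hζ,
      norm_natCast_eq_zpow hp.ne_zero, padicValNat_self, Nat.cast_one, zpow_neg_one, Real.logb_inv,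
      Real.logb_self_eq_one (Nat.one_lt_cast.2 hp.one_lt)]
  rw [nu_of_ne_zero (pow_ne_zero s (sub_ne_zero.2 (hζ.ne_one hp.one_lt).symm)), norm_pow,
    Real.logb_pow, eq_div_of_mul_eq hp₁.ne' ((mul_comm _ _).trans hlogb)]
  congr 1
  ring

end Valuation

section TraceCodes

variable {p : ℕ} [Fact p.Prime]

open Classical in
theorem codeValuation_eq_nu {K : Type*} [Field K] {n : ℕ} {D : Submodule K (Fin n → K)}
    {c₀ : Fin n → K} (hc₀ : c₀ ∈ D)
    (hmax : ∀ c ∈ D, ‖(hammingNorm c : ℂ_[p])‖ ≤ ‖(hammingNorm c₀ : ℂ_[p])‖) :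
    codeValuation p D = nu p (hammingNorm c₀ : ℂ_[p]) := by
  have hdvd (t : ℕ) : IsDivisibleCode D (p ^ t) ↔ p ^ t ∣ hammingNorm c₀ := by
    refine ⟨fun h => by convert h c₀ hc₀, fun h c hc => ?_⟩
    convert natCast_le_nu_natCast_iff.1
      ((natCast_le_nu_natCast_iff.2 h).trans (nu_le_nu (hmax c hc)))
  simp only [codeValuation, hdvd, iSup_pow_dvd_eq_nu]

theorem mem_traceCode_iff {K F : Type*} [Field K] [Field F] [Algebra K F] {n k : ℕ}
    {C : Submodule F (Fin n → F)} {G : Matrix (Fin k) (Fin n) F} (hG : IsGeneratorMatrix G C)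
    {c : Fin n → K} :
    c ∈ traceCode K C ↔
      ∃ a : Fin k → F, (fun j => Algebra.trace K F (∑ i, a i * G i j)) = c := by
  have hcoord (a : Fin k → F) : (Algebra.trace K F).compLeft (Fin n) (∑ i, a i • G.row i) =
      fun j => Algebra.trace K F (∑ i, a i * G i j) := by
    funext j
    simp [Finset.sum_apply]
  rw [traceCode, Submodule.mem_map, ← hG]
  simp only [Submodule.restrictScalars_mem, Submodule.mem_span_range_iff_exists_fun,
    exists_exists_eq_and, hcoord]

open Classical in
theorem isLeast_nu_weightCoeff {K F : Type*} [Field K] [Fintype K] [Field F] [Fintype F]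
    [Algebra K F] [Algebra (ZMod p) K] [Algebra (ZMod p) F] [IsScalarTower (ZMod p) K F]
    {n k : ℕ} [NeZero k] {C : Submodule F (Fin n → F)} {G : Matrix (Fin k) (Fin n) F}
    (hG : IsGeneratorMatrix G C) {ω : MulChar F ℂ_[p]} (hω : Function.Injective ω) {ζ : ℂ_[p]}
    (hζ : IsPrimitiveRoot ζ p) :
    IsLeast ((fun r => nu p (weightCoeff ω (traceChar F hζ.pow_eq_one) G r / Fintype.card K)) ''
        weightExponents (Fin k) (Fintype.card K) (Fintype.card F))
      (codeValuation p (traceCode K C)) := by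
  have hK : 0 < ‖(Fintype.card K : ℂ_[p])‖ :=
    norm_pos_iff.2 (Nat.cast_ne_zero.2 Fintype.card_ne_zero)
  obtain ⟨a₀, hmax⟩ := Finite.exists_max fun a : Fin k → F =>
    ‖(hammingNorm fun j => Algebra.trace K F (∑ i, a i * G i j) : ℂ_[p])‖
  have hval := codeValuation_eq_nu ((mem_traceCode_iff (K := K) hG).2 ⟨a₀, rfl⟩) fun c hc => by
    obtain ⟨a, rfl⟩ := (mem_traceCode_iff hG).1 hc
    exact hmax a
  have hlower : ∀ r ∈ weightExponents (Fin k) (Fintype.card K) (Fintype.card F),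
      codeValuation p (traceCode K C) ≤
        nu p (weightCoeff ω (traceChar F hζ.pow_eq_one) G r / Fintype.card K) := fun r hr => by
    rw [hval]
    refine nu_le_nu ?_
    rw [norm_div, div_le_iff₀' hK]
    exact norm_weightCoeff_le norm_p_lt_one hω hζ G hmax hr
  obtain ⟨r, hr, hle⟩ :=
    exists_norm_hammingNorm_le_norm_weightCoeff (K := K) norm_p_lt_one hω hζ G a₀
  refine ⟨⟨r, hr, (hlower r hr).antisymm' ?_⟩, Set.forall_mem_image.2 hlower⟩
  rw [hval]
  refine nu_le_nu ?_
  rwa [norm_div, le_div_iff₀' hK]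

theorem nu_weightCoeff_div {F : Type*} [Field F] [Fintype F] [Algebra (ZMod p) F] {ι n : Type*}
    [Fintype ι] [Fintype n] {ω : MulChar F ℂ_[p]} (hω : IsMultiplicativeLift ω) {ζ : ℂ_[p]}
    (hζ : IsPrimitiveRoot ζ p) (G : Matrix ι n F) {r : ι → ℕ} (hr : ∀ i, r i < Fintype.card F)
    (e : ℕ) :
    nu p (weightCoeff ω (traceChar F hζ.pow_eq_one) G r / (p : ℂ_[p]) ^ e) =
      ((1 / ((p : ℝ) - 1) * ∑ i, (digitSum p (r i) : ℝ) : ℝ) : EReal) +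
        nu p (∑ j, ∏ i, ω (G i j) ^ r i) - ((e : ℝ) : EReal) := by
  have hnorm : ‖weightCoeff ω (traceChar F hζ.pow_eq_one) G r‖ =
      ‖(1 - ζ) ^ (∑ i, digitSum p (r i)) * ∑ j, ∏ i, ω (G i j) ^ r i‖ := by
    rw [norm_weightCoeff norm_p_lt_one hω hζ G hr, norm_mul, norm_pow]
  rw [nu_div_prime_pow, (nu_le_nu hnorm.le).antisymm' (nu_le_nu hnorm.ge), nu_mul,
    nu_one_sub_pow hζ, Nat.cast_sum]

theorem isLeast_codeValuation_traceCode {K F : Type*} [Field K] [Fintype K] [Field F] [Fintype F]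
    [Algebra K F] {e n k : ℕ} [NeZero k] (hK : Fintype.card K = p ^ e)
    {C : Submodule F (Fin n → F)} {G : Matrix (Fin k) (Fin n) F} (hG : IsGeneratorMatrix G C)
    {ω : MulChar F ℂ_[p]} (hω : IsMultiplicativeLift ω) :
    IsLeast
      ((fun r : Fin k → ℕ => ((1 / ((p : ℝ) - 1) * ∑ i, (digitSum p (r i) : ℝ) : ℝ) : EReal) +
          nu p (∑ j, ∏ i, ω (G i j) ^ r i) - ((e : ℝ) : EReal)) ''
        weightExponents (Fin k) (Fintype.card K) (Fintype.card F))
      (codeValuation p (traceCode K C)) := by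
  have : CharP K p := charP_of_card_eq_prime_pow hK
  have : CharP F p := charP_of_injective_algebraMap (algebraMap K F).injective p
  let _ : Algebra (ZMod p) K := ZMod.algebra K p
  let _ : Algebra (ZMod p) F := ZMod.algebra F p
  have : IsScalarTower (ZMod p) K F := IsScalarTower.of_algebraMap_eq' (Subsingleton.elim _ _)
  obtain ⟨ζ, hζ⟩ : ∃ ζ : ℂ_[p], IsPrimitiveRoot ζ p :=
    HasEnoughRootsOfUnity.exists_primitiveRoot ℂ_[p] p
  convert isLeast_nu_weightCoeff (K := K) hG hω.injective hζ using 1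
  refine Set.image_congr fun r hr => ?_
  rw [hK, Nat.cast_pow, nu_weightCoeff_div hω hζ G (mem_weightExponents.1 hr).1]

end TraceCodes

end TraceCode

theorem mainTheorem1 (p e q m : ℕ) [Fact p.Prime] (hq : q = p ^ e)
    (K F : Type*) [Field K] [Field F] [Finite K] [Finite F] [Algebra K F]
    (hK : Nat.card K = q) (hm : Module.finrank K F = m)
    (ξ : ℂ_[p]) (hξ : IsPrimitiveRoot ξ (q ^ m - 1)) (ι : TraceCode.ResidueRing p ξ ≃+* F)
    (n k : ℕ) (hk : 0 < k) (C : Submodule F (Fin n → F)) (G : Matrix (Fin k) (Fin n) F)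
    (hG : TraceCode.IsGeneratorMatrix G C) :
    IsLeast
      {v : EReal | ∃ r : Fin k → ℕ, (∀ i, r i ≤ q ^ m - 1) ∧ (q - 1) ∣ ∑ i, r i ∧ 0 < ∑ i, r i ∧
        v = ((1 / ((p : ℝ) - 1) * ∑ i, (TraceCode.digitSum p (r i) : ℝ) : ℝ) : EReal)
          + TraceCode.nu p (∑ j, ∏ i, TraceCode.teichmullerLift ι (G i j) ^ r i)
          - ((e : ℝ) : EReal)}
      (TraceCode.codeValuation p (TraceCode.traceCode K C)) := by
  have : NeZero k := ⟨hk.ne'⟩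
  have := Fintype.ofFinite K
  have := Fintype.ofFinite F
  have hcardK : Fintype.card K = q := by rw [← Nat.card_eq_fintype_card, hK]
  have hcardF : Fintype.card F = q ^ m := by rw [Module.card_eq_pow_finrank (K := K), hcardK, hm]
  have hF : Nat.card F = p ^ (e * m) := by rw [Nat.card_eq_fintype_card, hcardF, hq, pow_mul]
  have hξ' : IsPrimitiveRoot ξ (p ^ (e * m) - 1) := by rwa [pow_mul, ← hq]
  convert TraceCode.isLeast_codeValuation_traceCode (hcardK.trans hq) hG
    (TraceCode.isMultiplicativeLift_teichmullerChar hF hξ' ι) using 1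
  ext v
  refine exists_congr fun r => ?_
  have hpos : 0 < q ^ m := hcardF ▸ Fintype.card_pos
  simp only [Finset.mem_coe, TraceCode.mem_weightExponents, hcardK, hcardF,
    TraceCode.teichmullerChar_apply, Nat.le_sub_one_iff_lt hpos, and_assoc, eq_comm (a := v),
    and_left_comm (a := 0 < ∑ i, r i)]
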